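/- **Theorem 3.3.** Let $m,n\ge 1$ and $N\ge 2$ be integers. Let $\mathbb R^{m\times n}$ be the Euclidean space of real $m\times n$ matrices with norm $|A|=(\operatorname{tr}A^TA)^{1/2}$, let $\mathbb R^{m\times n}\times\mathbb R^{m\times n}$ carry the norm $|(A,B)|=(|A|^2+|B|^2)^{1/2}$, and let $$\Gamma=\{(p\otimes a,B): p\in\mathbb R^m,\ a\in\mathbb R^n\setminus\{0\},\ B\in\mathbb R^{m\times n},\ Ba=0\},\qquad p\otimes a=(p_ia_j).$$ Let $(\xi_1,\dots,\xi_N)$ be a $\mathcal T_N$-configuration determined by $(\rho,\gamma_1,\dots,\gamma_N,\kappa_1,\dots,\kappa_N)$; that is, $\rho\in\mathbb R^{m\times n}\times\mathbb R^{m\times n}$, $\gamma_1,\dots,\gamma_N\in\Gamma$, $\gamma_1+\dots+\gamma_N=0$, $\kappa_1,\dots,\kappa_N>1$, and $$\xi_i=\pi_i+\kappa_i\gamma_i,\qquad \pi_i=\rho+\gamma_1+\dots+\gamma_{i-1}\qquad(1\le i\le N,\ \pi_1=\rho).$$ Write $[\xi,\pi]$ for the closed segment from $\xi$ to $\pi$,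 and put $\mathcal T(\xi_1,\dots,\xi_N)=\bigcup_{j=1}^N[\xi_j,\pi_j]$. Let $\chi_k=1/\kappa_k\in(0,1)$, and, with indices read modulo $N$, $$\nu_i^{j}=\frac{(1-\chi_{i-1})(1-\chi_{i-2})\cdots(1-\chi_{j+1})\,\chi_j}{1-(1-\chi_1)\cdots(1-\chi_N)}\qquad(i-N\le j\le i-1),$$ where for $j=i-1$ the product of the factors $1-\chi_k$ is empty. Let $1\le i\le N$, $0\le\lambda\le1$ and $\eta=\lambda\xi_i+(1-\lambda)\pi_i$. Put $\nu_i=\lambda+(1-\lambda)\nu_i^i$ and $\nu_j=(1-\lambda)\nu_i^j$ for $j\ne i$ in $\{1,\dots,N\}$. Then $\nu_j\ge0$, $\sum_{j=1}^N\nu_j=1$ and $$\eta=\sum_{j=1}^N\nu_j\xi_j .$$ Moreover, for every bounded open set $G\subset\mathbb R^{n+1}=\{(x,t):x\in\mathbb R^n,\ t\in\mathbb R\}$ and every $0<\delta<1$ there is a smooth function $(\varphi,\psi,g)$, with values in $\mathbb R^m\times\mathbb R^{m\times n}\times\mathbb R^{m\times n}$ and with compact support contained in $G$, such that the following hold, where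 $D\varphi=(\partial\varphi^i/\partial x_j)$ and $(\operatorname{div}\psi)_i=\sum_j\partial\psi_{ij}/\partial x_j$ are taken in the variable $x$ only, and $|\cdot|$ of a set is its Lebesgue measure. (a) In $G$: $\operatorname{div}\psi=0$, $\operatorname{div}g=\varphi$, and $\eta+(D\varphi,\partial_t\psi)$ lies in the open $\delta$-neighborhood of $\mathcal T(\xi_1,\dots,\xi_N)$. (b) $\|\varphi\|_{L^\infty(G)}+\|\partial_t\varphi\|_{L^\infty(G)}+\|\partial_tg\|_{L^\infty(G)}<\delta$. (c) There are pairwise disjoint open sets $G_1,\dots,G_N$, whose closures are compact and contained in $G$, such that for all $1\le j\le N$ $$\eta+(D\varphi,\partial_t\psi)=\xi_j\ \text{ in } G_j\qquad\text{and}\qquad |G_j|\ge(1-\delta)\,\nu_j\,|G| ;$$ in particular $\bigl|\bigcup_{j=1}^NG_j\bigr|=\sum_{j=1}^N|G_j|\ge(1-\delta)|G|$. -/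

import Mathlib

open MeasureTheory
open scoped ContDiff

noncomputable section

/-- The Euclidean space of real `m × n` matrices, with inner product `tr (Aᵀ B)` and the associated
(Frobenius) norm; the `(i, j)` entry of `A` is `A (i, j)`. -/
abbrev Mat (m n : ℕ) : Type := EuclideanSpace ℝ (Fin m × Fin n)

/-- The Euclidean space `ℝ^{m × n} × ℝ^{m × n}`, with norm `|(A, B)| = (|A|² + |B|²)^{1/2}`. -/
abbrev MatPair (m n : ℕ) : Type := WithLp 2 (Mat m n × Mat m n)

/-- The pair `(A, B)` of matrices. -/
def mkPair {m n : ℕ} (A B : Mat m n) : MatPair m n := WithLp.toLp 2 (A, B)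

/-- Space-time `ℝ^{n+1} = ℝⁿ × ℝ`, with points `(x, t)`. Its volume is the product of the Lebesgue
measures of `ℝⁿ` and `ℝ`, that is, the `(n+1)`-dimensional Lebesgue measure. -/
abbrev SpaceTime (n : ℕ) : Type := EuclideanSpace ℝ (Fin n) × ℝ

/-- The tensor product `p ⊗ a`, i.e. the matrix `(pᵢ aⱼ)`. -/
def tensor {m n : ℕ} (p : EuclideanSpace ℝ (Fin m)) (a : EuclideanSpace ℝ (Fin n)) : Mat m n :=
  WithLp.toLp 2 fun ij => p ij.1 * a ij.2

/-- The matrix-vector product `B a`. -/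
def matVec {m n : ℕ} (B : Mat m n) (a : EuclideanSpace ℝ (Fin n)) : EuclideanSpace ℝ (Fin m) :=
  WithLp.toLp 2 fun i => ∑ j, B (i, j) * a j

/-- The wave cone `Γ = {(p ⊗ a, B) : p ∈ ℝᵐ, a ∈ ℝⁿ \ {0}, B ∈ ℝ^{m × n}, B a = 0}`. -/
def waveCone (m n : ℕ) : Set (MatPair m n) :=
  {γ | ∃ (p : EuclideanSpace ℝ (Fin m)) (a : EuclideanSpace ℝ (Fin n)) (B : Mat m n),
    a ≠ 0 ∧ matVec B a = 0 ∧ γ = mkPair (tensor p a) B}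

/-- The points `π₁ = ρ` and `πᵢ = ρ + γ₁ + ⋯ + γᵢ₋₁`. The indices `1, …, N` are represented by the
elements `0, …, N - 1` of `Fin N`. -/
def vertex {m n N : ℕ} (ρ : MatPair m n) (γ : Fin N → MatPair m n) (i : Fin N) : MatPair m n :=
  ρ + ∑ k ∈ Finset.Iio i, γ k

/-- The ordered tuple `ξ = (ξ₁, …, ξ_N)` is a `𝒯_N`-configuration determined by
`(ρ, γ₁, …, γ_N, κ₁, …, κ_N)`. -/
structure IsTNConfigurationWith {m n N : ℕ} (ξ : Fin N → MatPair m n)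
    (ρ : MatPair m n) (γ : Fin N → MatPair m n) (κ : Fin N → ℝ) : Prop where
  mem_waveCone : ∀ i, γ i ∈ waveCone m n
  one_lt : ∀ i, 1 < κ i
  sum_eq_zero : ∑ i, γ i = 0
  eq_add : ∀ i, ξ i = vertex ρ γ i + κ i • γ i

/-- The set `𝒯(ξ₁, …, ξ_N)`, the union of the closed segments `[ξⱼ, πⱼ]`. -/
def configSet {m n N : ℕ} (ξ : Fin N → MatPair m n) (ρ : MatPair m n)
    (γ : Fin N → MatPair m n) : Set (MatPair m n) :=
  ⋃ j, segment ℝ (ξ j) (vertex ρ γ j)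

/-- The coefficients
`νᵢʲ = (1 - tᵢ₋₁)(1 - tᵢ₋₂) ⋯ (1 - tⱼ₊₁) tⱼ / (1 - (1 - t₁) ⋯ (1 - t_N))`
for `i - N ≤ j ≤ i - 1`, where the indices are read modulo `N`, and where the product of the factors
`1 - tₖ` is empty for `j = i - 1`. For `j < i` in `{1, …, N}` the index `k` of these factors runs
through `j < k < i`; for `j ≥ i` in `{1, …, N}` it wraps around, and runs through `k > j` and
`k < i`. -/
def cyclicCoeff {N : ℕ} (t : Fin N → ℝ) (i j : Fin N) : ℝ :=
  (if j < i then (∏ k ∈ Finset.Ioo j i, (1 - t k)) * t j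
    else (∏ k ∈ Finset.Iio i, (1 - t k)) * (∏ k ∈ Finset.Ioi j, (1 - t k)) * t j) /
  (1 - ∏ k, (1 - t k))

/-- The weights `νᵢ = μ + (1 - μ) νᵢⁱ` and `νⱼ = (1 - μ) νᵢʲ` for `j ≠ i`, where the coefficients
`νᵢʲ` are formed with `tₖ = χₖ = 1 / κₖ`. -/
def blockWeight {N : ℕ} (κ : Fin N → ℝ) (i : Fin N) (μ : ℝ) (j : Fin N) : ℝ :=
  if j = i then μ + (1 - μ) * cyclicCoeff (fun k => 1 / κ k) i i
  else (1 - μ) * cyclicCoeff (fun k => 1 / κ k) i j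

section Calculus

variable {m n : ℕ} {F : Type*} [NormedAddCommGroup F] [NormedSpace ℝ F]

/-- The class `C₀^∞(G; F)`: smooth functions on `ℝ^{n+1}` whose support is compact and contained
in `G`. -/
structure IsTestFunction (G : Set (SpaceTime n)) (f : SpaceTime n → F) : Prop where
  smooth : ContDiff ℝ ∞ f
  compact_support : HasCompactSupport f
  support_subset : tsupport f ⊆ G

/-- The partial derivative `∂f/∂xⱼ`. -/
def dSpace (j : Fin n) (f : SpaceTime n → F) (z : SpaceTime n) : F :=
  fderiv ℝ f z (EuclideanSpace.single j 1, 0)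

/-- The partial derivative `∂ₜ f`. -/
def dTime (f : SpaceTime n → F) (z : SpaceTime n) : F :=
  fderiv ℝ f z (0, 1)

/-- The spatial gradient `Dφ = (∂φⁱ/∂xⱼ)`, an `m × n` matrix. -/
def spaceGrad (φ : SpaceTime n → EuclideanSpace ℝ (Fin m)) (z : SpaceTime n) : Mat m n :=
  WithLp.toLp 2 fun ij => dSpace ij.2 φ z ij.1

/-- The spatial (row-wise) divergence of a matrix field: `(div ψ)ᵢ = ∑ⱼ ∂ψᵢⱼ/∂xⱼ`. -/
def spaceDiv (ψ : SpaceTime n → Mat m n) (z : SpaceTime n) : EuclideanSpace ℝ (Fin m) :=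
  WithLp.toLp 2 fun i => ∑ j, dSpace j ψ z (i, j)

end Calculus

end

/-! Convex integration along the cycle. A cone direction `γ = (p ⊗ a, B)` with `B a = 0` admits a
scalar potential: with `b = a / |a|²`, put `φ = (∂_b u) p`, `ψ_ij = c⁻¹ (B_ij ∂_b u - b_j (B_i ·
∇u))` and `g = u p ⊗ b`. Then `div g = φ`, and `div ψ = 0` by symmetry of the Hessian. For `u = χ
k⁻² H(k(a·x + ct))` the Hessian is `χ H'' L ⊗ L + O(1/k)`, where `L = a·x + ct`, so `(Dφ, ∂ₜψ)` is
close to `χ H'' γ`, while `φ` and `∂ₜg` are `O(1/k)` and `∂ₜφ` is of order `c + 1/k`. If `H''`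
equals `1 - l` and `-l` on nearly the proportions `l` and `1 - l` of a period, the point `l ξᵢ + (1
- l) πᵢ` is split into the exact values `ξᵢ` and `πᵢ` on open sets filling nearly these fractions of
`G`; elsewhere the values stay near the segment (`exists_splitting`).

On the set with value `πᵢ` the construction is repeated, because `πᵢ = χ_k ξ_k + (1 - χ_k) π_k` for
the cyclic predecessor `k` of `i` (`Approximable.segment`). Going round the cycle, the part not yet
carried to some `ξⱼ` shrinks geometrically, and the fractions tend to `νᵢʲ`, which satisfy the same
recursion (`cyclicCoeff_eq_of_isCyclicPred`, `IsTNConfigurationWith.approximable_vertex`). One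
preliminary splitting of `η` on `[ξᵢ, πᵢ]` gives the weights `νⱼ`. The same recursion, being a
strict contraction around the cycle, also yields the algebraic identities. -/

noncomputable section

/-! ### Algebra of the weights and vertices around the cycle. -/

section CyclicAlgebra

/-- The cyclic predecessor `k` of `i`, in the form in which the wrap-around is needed. -/
def IsCyclicPred {N : ℕ} (k i : Fin N) : Prop :=
  (k : ℕ) + 1 = i ∨ ((i : ℕ) = 0 ∧ (k : ℕ) + 1 = N)

lemma exists_isCyclicPred {N : ℕ} (i : Fin N) : ∃ k, IsCyclicPred k i := by
  by_cases h : (i : ℕ) = 0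
  · exact ⟨⟨N - 1, by omega⟩, Or.inr ⟨h, by simp; omega⟩⟩
  · exact ⟨⟨i - 1, by omega⟩, Or.inl (by simp; omega)⟩

/-- Passing from `k` to its successor `i` appends the factor `1 - t k` to the product. Only for `j =
k` does the product restart as empty instead of running once round the cycle; the normalizing
denominator accounts exactly for the difference. -/
lemma cyclicCoeff_eq_of_isCyclicPred {N : ℕ} (t : Fin N → ℝ) (hD : 1 - ∏ k, (1 - t k) ≠ 0)
    {k i : Fin N} (h : IsCyclicPred k i) (j : Fin N) :
    cyclicCoeff t i j = (if j = k then t k else 0) + (1 - t k) * cyclicCoeff t k j := by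
  have hall : (∏ l ∈ Finset.Iio k, (1 - t l)) * (∏ l ∈ Finset.Ioi k, (1 - t l)) * (1 - t k) =
      ∏ l, (1 - t l) := by
    have h1 : (Finset.univ : Finset (Fin N)) =
        insert k (Finset.Iio k ∪ Finset.Ioi k) := by
      ext l; simp; omega
    rw [h1, Finset.prod_insert (by simp), Finset.prod_union]
    · ring
    · rw [Finset.disjoint_left]; intro l; simp; exact fun a => a.le
  unfold cyclicCoeff
  rcases lt_trichotomy j k with hjk | rfl | hjk
  · rw [if_neg hjk.ne, if_pos hjk]
    rcases h with h | ⟨h0, hN⟩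
    · rw [if_pos (by omega)]
      have : Finset.Ioo j i = insert k (Finset.Ioo j k) := by
        ext l; simp; omega
      rw [this, Finset.prod_insert (by simp)]
      ring
    · rw [if_neg (by omega)]
      have h1 : Finset.Iio i = ∅ := by ext l; simp; omega
      have h2 : Finset.Ioi j = insert k (Finset.Ioo j k) := by
        ext l; simp; omega
      rw [h1, h2, Finset.prod_insert (by simp)]
      simp; ring
  · rw [if_pos rfl, if_neg (lt_irrefl _)]
    -- The extra factor closes the cycle: with `P` the full product, the claim becomes `t j = t j (1
    -- - P) + t j P`.
    have key : (1 - t j) * ((∏ l ∈ Finset.Iio j, (1 - t l)) *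
        (∏ l ∈ Finset.Ioi j, (1 - t l)) * t j) = t j * ∏ l, (1 - t l) := by
      rw [← hall]; ring
    rw [← mul_div_assoc, key]
    rcases h with h | ⟨h0, hN⟩
    · rw [if_pos (by omega)]
      have : Finset.Ioo j i = ∅ := by ext l; simp; omega
      rw [this]; field_simp; simp
    · by_cases hji : j < i
      · omega
      rw [if_neg hji]
      have h1 : Finset.Iio i = ∅ := by ext l; simp; omega
      have h2 : Finset.Ioi j = ∅ := by ext l; simp; omega
      rw [h1, h2]; field_simp; simp
  · rcases h with h | ⟨h0, hN⟩
    · rw [if_neg hjk.ne', if_neg (by omega), if_neg (by omega)]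
      have : Finset.Iio i = insert k (Finset.Iio k) := by
        ext l; simp; omega
      rw [this, Finset.prod_insert (by simp)]
      ring
    · omega

/-- A cyclic recursion with contraction factors has only the zero solution. -/
lemma eq_zero_of_cyclic_contraction {N : ℕ} {F : Type*} [NormedAddCommGroup F] [NormedSpace ℝ F]
    (s : Fin N → ℝ) (hs0 : ∀ k, 0 ≤ s k) (hs1 : ∀ k, s k < 1) (d : Fin N → F)
    (hd : ∀ k i, IsCyclicPred k i → d i = s k • d k) (i : Fin N) : d i = 0 := by
  have : Nonempty (Fin N) := ⟨i⟩
  obtain ⟨l, hl⟩ := Finite.exists_max fun i => ‖d i‖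
  obtain ⟨k, hk⟩ := exists_isCyclicPred l
  have h1 : ‖d l‖ ≤ s k * ‖d l‖ := by
    calc ‖d l‖ = s k * ‖d k‖ := by rw [hd k l hk, norm_smul, Real.norm_of_nonneg (hs0 k)]
      _ ≤ s k * ‖d l‖ := mul_le_mul_of_nonneg_left (hl k) (hs0 k)
  have h2 : ‖d l‖ ≤ 0 := by
    by_contra! h
    nlinarith [hs1 k]
  exact norm_le_zero_iff.1 ((hl i).trans h2)

variable {N : ℕ} {t : Fin N → ℝ}

lemma prod_one_sub_lt_one (h0 : ∀ k, 0 < t k) (h1 : ∀ k, t k < 1) (i : Fin N) :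
    ∏ k, (1 - t k) < 1 := by
  calc ∏ k, (1 - t k) < ∏ _k : Fin N, (1 : ℝ) :=
        Finset.prod_lt_prod (fun k _ => by linarith [h1 k]) (fun k _ => by linarith [h0 k])
          ⟨i, Finset.mem_univ _, by linarith [h0 i]⟩
    _ = 1 := by simp

lemma cyclicCoeff_pos (h0 : ∀ k, 0 < t k) (h1 : ∀ k, t k < 1) (i j : Fin N) :
    0 < cyclicCoeff t i j := by
  have hp : ∀ s : Finset (Fin N), 0 < ∏ k ∈ s, (1 - t k) := fun s =>
    Finset.prod_pos fun k _ => by linarith [h1 k]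
  refine div_pos ?_ (by linarith [prod_one_sub_lt_one h0 h1 i])
  split_ifs
  · exact mul_pos (hp _) (h0 j)
  · exact mul_pos (mul_pos (hp _) (hp _)) (h0 j)

/-- The defect of the sum from `1` solves the homogeneous cyclic recursion with factors `1 - t k`,
hence vanishes. -/
lemma sum_cyclicCoeff (h0 : ∀ k, 0 < t k) (h1 : ∀ k, t k < 1) (i : Fin N) :
    ∑ j, cyclicCoeff t i j = 1 := by
  refine sub_eq_zero.1 (eq_zero_of_cyclic_contraction (fun k => 1 - t k)
    (fun k => by linarith [h1 k]) (fun k => by linarith [h0 k])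
    (fun i => ∑ j, cyclicCoeff t i j - 1) (fun k l hkl => ?_) i)
  have hD : 1 - ∏ k, (1 - t k) ≠ 0 := by linarith [prod_one_sub_lt_one h0 h1 i]
  simp only [cyclicCoeff_eq_of_isCyclicPred t hD hkl, Finset.sum_add_distrib, ← Finset.mul_sum,
    Finset.sum_ite_eq', Finset.mem_univ, if_true, smul_eq_mul]
  ring

lemma cyclicCoeff_le_one (h0 : ∀ k, 0 < t k) (h1 : ∀ k, t k < 1) (i j : Fin N) :
    cyclicCoeff t i j ≤ 1 := by
  rw [← sum_cyclicCoeff h0 h1 i]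
  exact Finset.single_le_sum (fun k _ => (cyclicCoeff_pos h0 h1 i k).le) (Finset.mem_univ j)

variable {m n : ℕ} {ξ : Fin N → MatPair m n} {ρ : MatPair m n} {γ : Fin N → MatPair m n}
  {κ : Fin N → ℝ}

/-- The wrap-around from the last vertex to the first is where the closing condition on the `γ i`
enters. -/
lemma vertex_eq_of_isCyclicPred (hγ : ∑ i, γ i = 0) {k i : Fin N} (h : IsCyclicPred k i) :
    vertex ρ γ i = vertex ρ γ k + γ k := by
  unfold vertex
  rcases h with h | ⟨h0, hN⟩
  · have : Finset.Iio i = insert k (Finset.Iio k) := by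
      ext l; simp; omega
    rw [this, Finset.sum_insert (by simp)]
    abel
  · have h1 : Finset.Iio i = ∅ := by ext l; simp; omega
    have h2 : (Finset.univ : Finset (Fin N)) = insert k (Finset.Iio k) := by
      ext l; simp; omega
    rw [h2, Finset.sum_insert (by simp)] at hγ
    rw [h1, add_assoc, add_comm _ (γ k), hγ]
    simp

namespace IsTNConfigurationWith

lemma inv_pos (hξ : IsTNConfigurationWith ξ ρ γ κ) (k : Fin N) : 0 < 1 / κ k :=
  one_div_pos.2 (by linarith [hξ.one_lt k])

lemma inv_lt_one (hξ : IsTNConfigurationWith ξ ρ γ κ) (k : Fin N) : 1 / κ k < 1 := by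
  rw [div_lt_one (by linarith [hξ.one_lt k])]
  exact hξ.one_lt k

lemma vertex_eq (hξ : IsTNConfigurationWith ξ ρ γ κ) {k i : Fin N} (h : IsCyclicPred k i) :
    vertex ρ γ i = (1 / κ k) • ξ k + (1 - 1 / κ k) • vertex ρ γ k := by
  have hk : κ k ≠ 0 := by linarith [hξ.one_lt k]
  rw [vertex_eq_of_isCyclicPred hξ.sum_eq_zero h, hξ.eq_add k, smul_add, smul_smul,
    one_div_mul_cancel hk, sub_smul, one_smul, one_smul]
  abel

/-- Both sides obey the recursion of `vertex_eq`, so their difference is killed by the contraction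
argument. -/
lemma vertex_eq_sum (hξ : IsTNConfigurationWith ξ ρ γ κ) (i : Fin N) :
    vertex ρ γ i = ∑ j, cyclicCoeff (fun k => 1 / κ k) i j • ξ j := by
  refine sub_eq_zero.1 (eq_zero_of_cyclic_contraction (fun k => 1 - 1 / κ k)
    (fun k => by linarith [hξ.inv_lt_one k]) (fun k => by linarith [hξ.inv_pos k])
    (fun i => vertex ρ γ i - ∑ j, cyclicCoeff (fun k => 1 / κ k) i j • ξ j)
    (fun k l hkl => ?_) i)
  have hD : 1 - ∏ k, (1 - 1 / κ k) ≠ 0 := by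
    linarith [prod_one_sub_lt_one hξ.inv_pos hξ.inv_lt_one i]
  simp only [cyclicCoeff_eq_of_isCyclicPred (fun k => 1 / κ k) hD hkl, add_smul,
    Finset.sum_add_distrib, ite_smul, zero_smul, Finset.sum_ite_eq', Finset.mem_univ, if_true,
    mul_smul, ← Finset.smul_sum, hξ.vertex_eq hkl, smul_sub]
  abel

end IsTNConfigurationWith

lemma blockWeight_eq (κ : Fin N → ℝ) (i : Fin N) (μ : ℝ) (j : Fin N) :
    blockWeight κ i μ j =
      (if j = i then μ else 0) + (1 - μ) * cyclicCoeff (fun k => 1 / κ k) i j := by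
  unfold blockWeight
  split_ifs with h
  · rw [h]
  · rw [zero_add]

lemma IsTNConfigurationWith.sum_blockWeight_smul (hξ : IsTNConfigurationWith ξ ρ γ κ)
    (i : Fin N) (μ : ℝ) :
    ∑ j, blockWeight κ i μ j • ξ j = μ • ξ i + (1 - μ) • vertex ρ γ i := by
  simp only [blockWeight_eq, add_smul, Finset.sum_add_distrib, ite_smul, zero_smul,
    Finset.sum_ite_eq', Finset.mem_univ, if_true, mul_smul, ← Finset.smul_sum,
    ← hξ.vertex_eq_sum]

lemma IsTNConfigurationWith.blockWeight_nonneg (hξ : IsTNConfigurationWith ξ ρ γ κ)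
    (i : Fin N) {μ : ℝ} (h0 : 0 ≤ μ) (h1 : μ ≤ 1) (j : Fin N) : 0 ≤ blockWeight κ i μ j := by
  rw [blockWeight_eq]
  have := mul_nonneg (sub_nonneg.2 h1) (cyclicCoeff_pos hξ.inv_pos hξ.inv_lt_one i j).le
  split_ifs <;> linarith

lemma IsTNConfigurationWith.sum_blockWeight (hξ : IsTNConfigurationWith ξ ρ γ κ)
    (i : Fin N) (μ : ℝ) : ∑ j, blockWeight κ i μ j = 1 := by
  simp only [blockWeight_eq, Finset.sum_add_distrib, Finset.sum_ite_eq', Finset.mem_univ, if_true,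
    ← Finset.mul_sum, sum_cyclicCoeff hξ.inv_pos hξ.inv_lt_one]
  ring

end CyclicAlgebra

/-! ### One-dimensional periodic oscillation profiles. -/

section Profile

/-- A smooth periodic function with zero mean has a smooth periodic primitive with zero mean. -/
lemma exists_periodic_primitive {f : ℝ → ℝ} (hf : ContDiff ℝ ∞ f) (hp : Function.Periodic f 1)
    (h0 : ∫ s in (0 : ℝ)..1, f s = 0) :
    ∃ h : ℝ → ℝ, ContDiff ℝ ∞ h ∧ Function.Periodic h 1 ∧ (∫ s in (0 : ℝ)..1, h s = 0) ∧
      ∀ s, HasDerivAt h (f s) s := by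
  have hint : ∀ a b, IntervalIntegrable f volume a b := fun a b =>
    hf.continuous.intervalIntegrable a b
  set F : ℝ → ℝ := fun s => ∫ r in (0 : ℝ)..s, f r with hF
  have hFd : ∀ s, HasDerivAt F (f s) s := fun s =>
    intervalIntegral.integral_hasDerivAt_right (hint 0 s)
      hf.continuous.aestronglyMeasurable.stronglyMeasurableAtFilter hf.continuous.continuousAt
  have hFp : Function.Periodic F 1 := fun s => by
    have h1 := hp.intervalIntegral_add_eq s 0
    rw [zero_add, h0] at h1
    simp only [hF]
    rw [← intervalIntegral.integral_add_adjacent_intervals (hint 0 s) (hint s (s + 1)), h1,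
      add_zero]
  have hFc : Continuous F :=
    continuous_iff_continuousAt.2 fun s => (hFd s).continuousAt
  refine ⟨fun s => F s - ∫ r in (0 : ℝ)..1, F r, ?_, fun s => by simp only [hFp s], ?_,
    fun s => (hFd s).sub_const _⟩
  · refine ContDiff.sub ?_ contDiff_const
    rw [contDiff_infty_iff_deriv]
    refine ⟨fun s => (hFd s).differentiableAt, ?_⟩
    rwa [show deriv F = f from funext fun s => (hFd s).deriv]
  · rw [intervalIntegral.integral_sub (hFc.intervalIntegrable _ _)
      (continuous_const.intervalIntegrable _ _)]
    simp

lemma Function.Periodic.exists_abs_le {h : ℝ → ℝ} (hp : Function.Periodic h 1)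
    (hc : Continuous h) : ∃ C, ∀ s, |h s| ≤ C := by
  obtain ⟨C, hC⟩ := isCompact_Icc.exists_bound_of_continuousOn (s := Set.Icc (0 : ℝ) 1)
    hc.continuousOn
  refine ⟨C, fun s => ?_⟩
  have := hC (Int.fract s) ⟨Int.fract_nonneg s, (Int.fract_lt_one s).le⟩
  have hs : h (Int.fract s) = h s := by
    have := hp.sub_zsmul_eq (x := s) ⌊s⌋
    rwa [zsmul_one, Int.self_sub_floor] at this
  rwa [hs] at this

/-- Periodization of a smooth function vanishing outside a compact part of `(0, 1)`. -/
lemma contDiff_comp_fract {b : ℝ → ℝ} (hb : ContDiff ℝ ∞ b) {α β : ℝ} (hα : 0 < α) (hβ : β < 1)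
    (h1 : ∀ s ≤ α, b s = 0) (h2 : ∀ s, β ≤ s → b s = 0) :
    ContDiff ℝ ∞ fun s => b (Int.fract s) := by
  rw [contDiff_iff_contDiffAt]
  intro s
  have hlocal : (fun r : ℝ => b (Int.fract r)) =ᶠ[nhds s] fun r : ℝ => b (r - (⌊s⌋ : ℝ)) := by
    -- On a left neighbourhood of an integer shorter than both margins, `b` vanishes on either side
    -- of the jump of the fractional part.
    have hmin : 0 < min α (1 - β) := lt_min hα (by linarith)
    have e1 : ∀ᶠ r in nhds s, (⌊s⌋ : ℝ) - min α (1 - β) < r :=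
      lt_mem_nhds (by linarith [Int.floor_le s])
    have e2 : ∀ᶠ r in nhds s, r < (⌊s⌋ : ℝ) + 1 := gt_mem_nhds (Int.lt_floor_add_one s)
    filter_upwards [e1, e2] with r hr1 hr2
    by_cases hr : (⌊s⌋ : ℝ) ≤ r
    · have : ⌊r⌋ = ⌊s⌋ := Int.floor_eq_iff.2 ⟨hr, hr2⟩
      rw [← Int.self_sub_floor, this]
    · push Not at hr
      have hα' := min_le_left α (1 - β)
      have hβ' := min_le_right α (1 - β)
      by_cases hα1 : min α (1 - β) ≤ 1
      · have : ⌊r⌋ = ⌊s⌋ - 1 := Int.floor_eq_iff.2 ⟨by push_cast; linarith, by push_cast; linarith⟩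
        rw [← Int.self_sub_floor, this, h1 (r - ⌊s⌋) (by linarith), h2]
        push_cast; linarith
      -- Margins larger than `1` mean `β < 0` and `1 < α`, so the two vanishing regions cover the
      -- line.
      · have hz : ∀ x, b x = 0 := fun x => by
          rcases le_total x α with h | h
          · exact h1 x h
          · exact h2 x (by linarith)
        rw [hz, hz]
  exact (hb.contDiffAt.comp s (contDiffAt_id.sub contDiffAt_const)).congr_of_eventuallyEq hlocal

lemma integral_comp_fract (b : ℝ → ℝ) :
    ∫ s in (0 : ℝ)..1, b (Int.fract s) = ∫ s in (0 : ℝ)..1, b s := by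
  refine intervalIntegral.integral_congr_ae ?_
  filter_upwards [compl_mem_ae_iff.2 (measure_singleton (1 : ℝ))] with s hs hs1
  rw [Set.uIoc_of_le zero_le_one] at hs1
  rw [Int.fract_eq_self.2 ⟨hs1.1.le, lt_of_le_of_ne hs1.2 hs⟩]

/-- A smooth two-plateau function vanishing outside a compact part of `(0, 1)`, with integral `l`. -/
lemma exists_plateau {l e : ℝ} (hl : 0 ≤ l) (he : 0 < e) (hle : l + 2 * e < 1) :
    ∃ b : ℝ → ℝ, ContDiff ℝ ∞ b ∧ (∀ s, b s ∈ Set.Icc (0 : ℝ) 1) ∧ (∀ s ≤ e, b s = 0) ∧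
      (∀ s, l + 2 * e ≤ s → b s = 0) ∧ (∀ s ∈ Set.Icc (2 * e) (l + e), b s = 1) ∧
      ∫ s in (0 : ℝ)..1, b s = l := by
  set τ : ℝ → ℝ := fun s => Real.smoothTransition (s / e) with hτ
  have hτs : ContDiff ℝ ∞ τ := Real.smoothTransition.contDiff.comp (contDiff_id.div_const e)
  have hτm : Monotone τ := fun x y hxy =>
    Real.smoothTransition.monotone ((div_le_div_iff_of_pos_right he).2 hxy)
  have hτ0 : ∀ s ≤ 0, τ s = 0 := fun s hs =>
    Real.smoothTransition.zero_of_nonpos (div_nonpos_of_nonpos_of_nonneg hs he.le)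
  have hτ1 : ∀ s, e ≤ s → τ s = 1 := fun s hs =>
    Real.smoothTransition.one_of_one_le ((one_le_div he).2 hs)
  have hτn : ∀ s, 0 ≤ τ s := fun s => Real.smoothTransition.nonneg _
  have hτl : ∀ s, τ s ≤ 1 := fun s => Real.smoothTransition.le_one _
  have hint : ∀ a b, IntervalIntegrable τ volume a b := fun a b =>
    hτs.continuous.intervalIntegrable a b
  -- The difference of a transition function and its translate by `l` has integral exactly `l`,
  -- whatever the shape of the ramp.
  refine ⟨fun s => τ (s - e) - τ (s - (l + e)), ?_, fun s => ⟨?_, ?_⟩, fun s hs => ?_,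
    fun s hs => ?_, fun s hs => ?_, ?_⟩
  · exact (hτs.comp (contDiff_id.sub contDiff_const)).sub
      (hτs.comp (contDiff_id.sub contDiff_const))
  · exact sub_nonneg.2 (hτm (by linarith))
  · linarith [hτn (s - (l + e)), hτl (s - e)]
  · simp only [hτ0 (s - e) (by linarith), hτ0 (s - (l + e)) (by linarith), sub_zero]
  · simp only [hτ1 (s - e) (by linarith), hτ1 (s - (l + e)) (by linarith), sub_self]
  · simp only [hτ1 (s - e) (by linarith [hs.1]), hτ0 (s - (l + e)) (by linarith [hs.2]), sub_zero]
  · have hc1 : IntervalIntegrable (fun s => τ (s - e)) volume 0 1 :=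
      (hτs.continuous.comp (continuous_id.sub continuous_const)).intervalIntegrable _ _
    have hc2 : IntervalIntegrable (fun s => τ (s - (l + e))) volume 0 1 :=
      (hτs.continuous.comp (continuous_id.sub continuous_const)).intervalIntegrable _ _
    rw [intervalIntegral.integral_sub hc1 hc2, intervalIntegral.integral_comp_sub_right,
      intervalIntegral.integral_comp_sub_right,
      intervalIntegral.integral_interval_sub_interval_comm' (hint _ _) (hint _ _) (hint _ _)]
    have i1 : ∫ s in (1 - (l + e))..(1 - e), τ s = l := by
      rw [intervalIntegral.integral_congr (g := fun _ => (1 : ℝ))]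
      · simp
      · intro s hs
        rw [Set.uIcc_of_le (by linarith)] at hs
        exact hτ1 s (by linarith [hs.1])
    have i2 : ∫ s in (0 - (l + e))..(0 - e), τ s = 0 := by
      rw [intervalIntegral.integral_congr (g := fun _ => (0 : ℝ))]
      · simp
      · intro s hs
        rw [Set.uIcc_of_le (by linarith)] at hs
        exact hτ0 s (by linarith [hs.2])
    rw [i1, i2, sub_zero]

/-- A bounded function whose second derivative is a zero-mean oscillation between `1 - l` and `-l`,
with prescribed proportions of the two values up to `e`. -/
lemma exists_profile {l : ℝ} (hl0 : 0 ≤ l) (hl1 : l ≤ 1) {e : ℝ} (he : 0 < e) :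
    ∃ f h H : ℝ → ℝ, ContDiff ℝ ∞ H ∧ (∀ s, HasDerivAt H (h s) s) ∧
      (∀ s, HasDerivAt h (f s) s) ∧ (∃ C, ∀ s, |H s| ≤ C) ∧ (∃ C, ∀ s, |h s| ≤ C) ∧
      (∀ s, f s ∈ Set.Icc (-l) (1 - l)) ∧
      (∃ α β, 0 ≤ α ∧ β ≤ 1 ∧ l - e ≤ β - α ∧
        ∀ s, Int.fract s ∈ Set.Ioo α β → f s = 1 - l) ∧
      (∃ α β, 0 ≤ α ∧ β ≤ 1 ∧ 1 - l - e ≤ β - α ∧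
        ∀ s, Int.fract s ∈ Set.Ioo α β → f s = -l) := by
  rcases hl1.eq_or_lt with rfl | hl1
  -- For `l = 1` there is no room for the ramps, but the required value `1 - l` is `0`, so the zero
  -- profile serves.
  · refine ⟨0, 0, 0, contDiff_const, fun s => hasDerivAt_const s 0, fun s => hasDerivAt_const s 0,
      ⟨0, by simp⟩, ⟨0, by simp⟩, by simp, ⟨0, 1, le_rfl, le_rfl, by linarith, by simp⟩,
      ⟨0, 0, le_rfl, zero_le_one, by linarith, by simp⟩⟩
  -- The plateaus have lengths `l - e'` and `1 - l - 2 e'`: the first bound limits the loss to `e`,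
  -- the second keeps `l + 2 e' < 1`.
  set e' := min (e / 2) ((1 - l) / 3) with he'
  have hm1 : e' ≤ e / 2 := min_le_left _ _
  have hm2 : e' ≤ (1 - l) / 3 := min_le_right _ _
  have hm0 : 0 < e' := lt_min (by linarith) (by linarith)
  obtain ⟨b, hbs, hb01, hbl, hbr, hb1, hbi⟩ := exists_plateau hl0 hm0 (by linarith)
  set f : ℝ → ℝ := fun s => b (Int.fract s) - l with hf
  have hfs : ContDiff ℝ ∞ f :=
    (contDiff_comp_fract hbs hm0 (by linarith) hbl hbr).sub contDiff_const
  have hfp : Function.Periodic f 1 := fun s => by simp only [hf, Int.fract_add_one]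
  have hfi : ∫ s in (0 : ℝ)..1, f s = 0 := by
    have hc := (contDiff_comp_fract hbs hm0 (by linarith) hbl hbr).continuous
    simp only [hf]
    rw [intervalIntegral.integral_sub (hc.intervalIntegrable _ _)
      (continuous_const.intervalIntegrable _ _), integral_comp_fract, hbi]
    simp
  obtain ⟨h, hhs, hhp, hhi, hhd⟩ := exists_periodic_primitive hfs hfp hfi
  obtain ⟨H, hHs, hHp, -, hHd⟩ := exists_periodic_primitive hhs hhp hhi
  refine ⟨f, h, H, hHs, hHd, hhd, hHp.exists_abs_le hHs.continuous,
    hhp.exists_abs_le hhs.continuous, fun s => ⟨?_, ?_⟩,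
    ⟨2 * e', l + e', by linarith, by linarith, by linarith, fun s hs => ?_⟩,
    ⟨l + 2 * e', 1, by linarith, le_rfl, by linarith, fun s hs => ?_⟩⟩
  · simp only [hf]; linarith [(hb01 (Int.fract s)).1]
  · simp only [hf]; linarith [(hb01 (Int.fract s)).2]
  · simp only [hf, hb1 _ (Set.Ioo_subset_Icc_self hs)]
  · simp only [hf, hbr _ hs.1.le, zero_sub]

end Profile

/-! ### Equidistribution of the phase modulo one. -/

section Equidistribution

lemma isOpen_fract_preimage_Ioo {α β : ℝ} (hα : 0 ≤ α) (hβ : β ≤ 1) :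
    IsOpen (Int.fract ⁻¹' Set.Ioo α β : Set ℝ) := by
  have : (Int.fract ⁻¹' Set.Ioo α β : Set ℝ) = ⋃ k : ℤ, Set.Ioo (k + α) (k + β) := by
    ext s
    simp only [Set.mem_preimage, Set.mem_iUnion, Set.mem_Ioo]
    constructor
    · intro hs
      refine ⟨⌊s⌋, ?_, ?_⟩ <;> linarith [hs.1, hs.2, Int.self_sub_floor s]
    · rintro ⟨k, h1, h2⟩
      have : ⌊s⌋ = k := Int.floor_eq_iff.2 ⟨by linarith, by linarith⟩
      rw [← Int.self_sub_floor, this]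
      constructor <;> linarith
  rw [this]
  exact isOpen_iUnion fun k => isOpen_Ioo

/-- The integral of a periodic indicator over one period does not depend on the starting point, so
`y` may be taken to be `0`. -/
lemma volume_shift_fract_preimage_Ioo {α β : ℝ} (hα : 0 ≤ α) (hβ : β ≤ 1) (y : ℝ) :
    ENNReal.ofReal (β - α) ≤
      volume.restrict (Set.Ioc (0 : ℝ) 1) {σ | Int.fract (y + σ) ∈ Set.Ioo α β} := by
  set A : Set ℝ := Int.fract ⁻¹' Set.Ioo α β with hA
  have hAm : MeasurableSet A := (isOpen_fract_preimage_Ioo hα hβ).measurableSet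
  have hper : Function.Periodic (A.indicator fun _ => (1 : ℝ)) 1 := fun s => by
    simp only [Set.indicator, hA, Set.mem_preimage, Int.fract_add_one]
  have h1 := hper.intervalIntegral_add_eq y 0
  have h2 : ∫ s in y..(y + 1), A.indicator (fun _ => (1 : ℝ)) s =
      ∫ σ in (0 : ℝ)..1, A.indicator (fun _ => (1 : ℝ)) (y + σ) := by
    rw [intervalIntegral.integral_comp_add_left, add_zero]
  have h3 : ∀ y : ℝ, ∫ σ in (0 : ℝ)..1, A.indicator (fun _ => (1 : ℝ)) (y + σ) =
      (volume.restrict (Set.Ioc (0 : ℝ) 1)).real {σ | Int.fract (y + σ) ∈ Set.Ioo α β} := by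
    intro y
    have hBm : MeasurableSet ((fun σ => y + σ) ⁻¹' A) :=
      measurableSet_preimage (measurable_const_add y) hAm
    rw [intervalIntegral.integral_of_le zero_le_one, show
      {σ | Int.fract (y + σ) ∈ Set.Ioo α β} = (fun σ => y + σ) ⁻¹' A from rfl,
      ← integral_indicator_one hBm]
    rfl
  rw [h2, h3, zero_add] at h1
  have h4 := h3 0
  simp only [zero_add] at h4
  rw [h4] at h1
  rw [← ENNReal.ofReal_toReal (measure_ne_top _ {σ | Int.fract (y + σ) ∈ Set.Ioo α β})]
  refine ENNReal.ofReal_le_ofReal ?_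
  change _ ≤ (volume.restrict (Set.Ioc (0 : ℝ) 1)).real _
  rw [h1]
  have h5 : (volume.restrict (Set.Ioc (0 : ℝ) 1)).real (Set.Ioo α β) ≤
      (volume.restrict (Set.Ioc (0 : ℝ) 1)).real {σ | Int.fract σ ∈ Set.Ioo α β} := by
    refine measureReal_mono fun s hs => ?_
    simp only [Set.mem_ofPred_eq]
    rwa [Int.fract_eq_self.2 ⟨by linarith [hs.1], by linarith [hs.2]⟩]
  refine le_trans ?_ h5
  rw [measureReal_restrict_apply measurableSet_Ioo, Set.inter_eq_left.2]
  · rw [Real.volume_real_Ioo]; exact le_max_left _ _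
  · exact fun s hs => ⟨by linarith [hs.1], by linarith [hs.2]⟩

/-- The fractional part of a linear form is nearly equidistributed: a set containing the translates
of `K` along one period has a proportionate part where the fractional part lies in `(α, β)`. -/
lemma volume_inter_fract_ge {E : Type*} [NormedAddCommGroup E] [NormedSpace ℝ E]
    [MeasurableSpace E] [BorelSpace E] [SecondCountableTopology E] (ν : Measure E) [SFinite ν]
    [ν.IsAddRightInvariant] (L : E →L[ℝ] ℝ) {v : E} (hv : L v = 1) {K Ω : Set E}
    (hΩ : ν Ω ≠ ⊤)
    (h : ∀ σ ∈ Set.Icc (0 : ℝ) 1, ∀ z ∈ K, z + σ • v ∈ Ω) {α β : ℝ} (hα : 0 ≤ α) (hβ : β ≤ 1) :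
    (β - α) * ν.real K ≤ ν.real (Ω ∩ {z | Int.fract (L z) ∈ Set.Ioo α β}) := by
  set I : Measure ℝ := volume.restrict (Set.Ioc (0 : ℝ) 1) with hI
  set A : Set ℝ := Int.fract ⁻¹' Set.Ioo α β with hA
  have hAm : MeasurableSet A := (isOpen_fract_preimage_Ioo hα hβ).measurableSet
  -- Double counting over `K × (0, 1]`: for fixed `z` the slice has measure at least `β - α`; for
  -- fixed `σ` translation by `σ • v` carries the slice into the target set.
  set S : Set (E × ℝ) := {p | L p.1 + p.2 ∈ A} with hS
  have hSm : MeasurableSet S :=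
    measurableSet_preimage (by fun_prop : Measurable fun p : E × ℝ => L p.1 + p.2) hAm
  have hlow : ENNReal.ofReal (β - α) * ν K ≤ ((ν.restrict K).prod I) S := by
    rw [Measure.prod_apply hSm]
    calc ENNReal.ofReal (β - α) * ν K = ∫⁻ _ in K, ENNReal.ofReal (β - α) ∂ν := by simp
      _ ≤ _ := lintegral_mono fun z => volume_shift_fract_preimage_Ioo hα hβ (L z)
  have hup : ((ν.restrict K).prod I) S ≤ ν (Ω ∩ {z | Int.fract (L z) ∈ Set.Ioo α β}) := by
    rw [Measure.prod_apply_symm hSm]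
    calc _ ≤ ∫⁻ _ in Set.Ioc (0 : ℝ) 1, ν (Ω ∩ {z | Int.fract (L z) ∈ Set.Ioo α β}) := by
          refine setLIntegral_mono' measurableSet_Ioc fun σ hσ => ?_
          rw [Measure.restrict_apply (measurable_prodMk_right hSm),
            ← measure_preimage_add_right ν (σ • v) (Ω ∩ {z | Int.fract (L z) ∈ Set.Ioo α β})]
          refine measure_mono fun z hz => ⟨h σ ⟨hσ.1.le, hσ.2⟩ z hz.2, ?_⟩
          have := hz.1
          simp only [hS, hA, Set.mem_preimage, Set.mem_ofPred_eq] at this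
          simpa [hv] using this
      _ = _ := by simp
  have hfin : ν (Ω ∩ {z | Int.fract (L z) ∈ Set.Ioo α β}) ≠ ⊤ :=
    ne_top_of_le_ne_top hΩ (measure_mono Set.inter_subset_left)
  have := ENNReal.toReal_mono hfin (hlow.trans hup)
  rw [ENNReal.toReal_mul] at this
  refine le_trans (mul_le_mul_of_nonneg_right ?_ measureReal_nonneg) this
  rw [ENNReal.toReal_ofReal']
  exact le_max_left _ _

end Equidistribution

/-! ### Modulated rapid oscillations. -/

section Oscillation

lemma exists_norm_le_of_hasCompactSupport {X F : Type*} [TopologicalSpace X] [NormedAddCommGroup F]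
    {f : X → F} (hf : Continuous f) (hs : HasCompactSupport f) :
    ∃ C, 0 ≤ C ∧ ∀ x, ‖f x‖ ≤ C :=
  let ⟨C, hC⟩ := hf.bounded_above_of_compact_support hs
  ⟨max C 0, le_max_right _ _, fun x => (hC x).trans (le_max_left _ _)⟩

variable {E : Type*} [NormedAddCommGroup E] [NormedSpace ℝ E]

lemma norm_add_smul_add_le {F : Type*} [NormedAddCommGroup F] [NormedSpace ℝ F] {x y z : F}
    {w a b c d : ℝ} (hx : ‖x‖ ≤ a) (hw : ‖w‖ ≤ b) (hy : ‖y‖ ≤ c) (hz : ‖z‖ ≤ d) :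
    ‖x + (w • y + z)‖ ≤ a + (b * c + d) := by
  refine (norm_add_le _ _).trans (add_le_add hx ((norm_add_le _ _).trans (add_le_add ?_ hz)))
  rw [norm_smul]
  exact mul_le_mul hw hy (norm_nonneg _) ((norm_nonneg _).trans hw)

/-- A compactly supported modulation of a rapidly oscillating function of a linear form: its
gradient is small, and its Hessian is nearly `c • f • L ⊗ L`. -/
lemma exists_oscillation {c : E → ℝ} (hc : ContDiff ℝ ∞ c) (hcs : HasCompactSupport c)
    {f h H : ℝ → ℝ} (hHs : ContDiff ℝ ∞ H) (hH : ∀ s, HasDerivAt H (h s) s)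
    (hh : ∀ s, HasDerivAt h (f s) s) (hHb : ∃ C, ∀ s, |H s| ≤ C) (hhb : ∃ C, ∀ s, |h s| ≤ C)
    (L : E →L[ℝ] ℝ) {ε : ℝ} (hε : 0 < ε) :
    ∃ k₀ : ℝ, ∀ k > k₀, ∃ u : E → ℝ, ContDiff ℝ ∞ u ∧ tsupport u ⊆ tsupport c ∧
      (∀ z, ‖fderiv ℝ u z‖ ≤ ε) ∧
      (∀ z x, ‖fderiv ℝ (fderiv ℝ u) z x - (c z * f (k * L z) * L x) • L‖ ≤ ε * ‖x‖) ∧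
      ∀ z, (∀ᶠ y in nhds z, c y = 1) →
        ∀ x, fderiv ℝ (fderiv ℝ u) z x = (f (k * L z) * L x) • L := by
  obtain ⟨CH, hCH⟩ := hHb
  obtain ⟨Ch, hCh⟩ := hhb
  have hc1 : ContDiff ℝ ∞ (fderiv ℝ c) := hc.fderiv_right (by simp)
  have hc2 : ContDiff ℝ ∞ (fderiv ℝ (fderiv ℝ c)) := hc1.fderiv_right (by simp)
  have hcs1 : HasCompactSupport (fderiv ℝ c) := hcs.fderiv ℝ
  have hcs2 : HasCompactSupport (fderiv ℝ (fderiv ℝ c)) := hcs1.fderiv ℝ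
  obtain ⟨c0, hc0', hc0⟩ := exists_norm_le_of_hasCompactSupport hc.continuous hcs
  obtain ⟨d0, hd0', hd0⟩ := exists_norm_le_of_hasCompactSupport hc1.continuous hcs1
  obtain ⟨e0, he0', he0⟩ := exists_norm_le_of_hasCompactSupport hc2.continuous hcs2
  have hCH0 : 0 ≤ CH := (abs_nonneg _).trans (hCH 0)
  have hCh0 : 0 ≤ Ch := (abs_nonneg _).trans (hCh 0)
  -- `M1 / k` bounds the gradient and `M2 / k` the Hessian terms in which some derivative falls on
  -- `c`.
  set M1 := c0 * (Ch * ‖L‖) + CH * d0 with hM1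
  set M2 := d0 * (Ch * ‖L‖) + (CH * e0 + Ch * ‖L‖ * d0) with hM2
  have hM1' : 0 ≤ M1 := by positivity
  have hM2' : 0 ≤ M2 := by positivity
  refine ⟨max 1 ((M1 + M2) / ε), fun k hk => ?_⟩
  have hk1 : 1 < k := (le_max_left _ _).trans_lt hk
  have hk0 : 0 < k := by linarith
  have hkM : M1 + M2 < k * ε := (div_lt_iff₀ hε).1 ((le_max_right _ _).trans_lt hk)
  -- The factor `k⁻²` balances two derivatives, so the second derivative of `w` keeps unit size
  -- while `w` and its gradient are `O(1/k)`.
  set w : E → ℝ := fun z => k⁻¹ ^ 2 * H (k * L z) with hw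
  have hLk : ∀ z, HasFDerivAt (fun z => k * L z) (k • L) z := fun z =>
    L.hasFDerivAt.const_mul k
  have hws : ContDiff ℝ ∞ w :=
    contDiff_const.mul (hHs.comp (contDiff_const.mul L.contDiff))
  have hwd : ∀ z, HasFDerivAt w ((k⁻¹ * h (k * L z)) • L) z := fun z => by
    have := ((hH (k * L z)).comp_hasFDerivAt z (hLk z)).const_mul (k⁻¹ ^ 2)
    refine this.congr_fderiv ?_
    rw [smul_smul, smul_smul]
    congr 1
    field_simp
  have hwdd : ∀ z, HasFDerivAt (fun z => (k⁻¹ * h (k * L z)) • L)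
      (f (k * L z) • L.smulRight L) z := fun z => by
    have := (((hh (k * L z)).comp_hasFDerivAt z (hLk z)).const_mul k⁻¹).smul_const L
    refine this.congr_fderiv ?_
    ext x y
    simp only [ContinuousLinearMap.smulRight_apply, smul_apply, smul_eq_mul]
    field_simp
  have hcd : ∀ z, HasFDerivAt c (fderiv ℝ c z) z := fun z =>
    (hc.differentiable (by simp) z).hasFDerivAt
  have hcdd : ∀ z, HasFDerivAt (fderiv ℝ c) (fderiv ℝ (fderiv ℝ c) z) z := fun z =>
    (hc1.differentiable (by simp) z).hasFDerivAt
  set u : E → ℝ := fun z => c z * w z with hu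
  have hud : ∀ z, HasFDerivAt u (c z • ((k⁻¹ * h (k * L z)) • L) + w z • fderiv ℝ c z) z :=
    fun z => (hcd z).mul (hwd z)
  have hudf : fderiv ℝ u = fun z => c z • ((k⁻¹ * h (k * L z)) • L) + w z • fderiv ℝ c z :=
    funext fun z => (hud z).fderiv
  have hudd : ∀ z, fderiv ℝ (fderiv ℝ u) z =
      (c z • (f (k * L z) • L.smulRight L) +
        (fderiv ℝ c z).smulRight ((k⁻¹ * h (k * L z)) • L)) +
      (w z • fderiv ℝ (fderiv ℝ c) z +
        ((k⁻¹ * h (k * L z)) • L).smulRight (fderiv ℝ c z)) := fun z => by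
    rw [hudf]
    exact (((hcd z).smul (hwdd z)).add ((hwd z).smul (hcdd z))).fderiv
  have hwb : ∀ z, ‖w z‖ ≤ k⁻¹ * CH := fun z => by
    have hk2 : k⁻¹ ^ 2 ≤ k⁻¹ := by
      rw [sq]
      exact mul_le_of_le_one_left (by positivity) (inv_le_one_of_one_le₀ hk1.le)
    rw [hw]
    simp only [norm_mul, Real.norm_eq_abs, abs_of_nonneg (by positivity : (0 : ℝ) ≤ k⁻¹ ^ 2)]
    exact mul_le_mul hk2 (hCH _) (abs_nonneg _) (by positivity)
  have hwdb : ∀ z, ‖(k⁻¹ * h (k * L z)) • L‖ ≤ k⁻¹ * (Ch * ‖L‖) := fun z => by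
    rw [norm_smul, norm_mul, Real.norm_of_nonneg (by positivity : 0 ≤ k⁻¹), mul_assoc]
    gcongr
    exact hCh _
  have hkM1 : k⁻¹ * M1 ≤ ε := by
    rw [inv_mul_le_iff₀ hk0]; linarith
  have hkM2 : k⁻¹ * M2 ≤ ε := by
    rw [inv_mul_le_iff₀ hk0]; linarith
  refine ⟨u, hc.mul hws, ?_, fun z => ?_, fun z x => ?_, fun z hz x => ?_⟩
  · exact tsupport_mul_subset_left
  · rw [(hud z).fderiv]
    calc _ ≤ ‖c z‖ * ‖(k⁻¹ * h (k * L z)) • L‖ + ‖w z‖ * ‖fderiv ℝ c z‖ := by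
          refine (norm_add_le _ _).trans ?_
          rw [norm_smul (c z), norm_smul (w z)]
      _ ≤ c0 * (k⁻¹ * (Ch * ‖L‖)) + (k⁻¹ * CH) * d0 :=
          add_le_add (mul_le_mul (hc0 z) (hwdb z) (norm_nonneg _) hc0')
            (mul_le_mul (hwb z) (hd0 z) (norm_nonneg _) (by positivity))
      _ = k⁻¹ * M1 := by rw [hM1]; ring
      _ ≤ ε := hkM1
  · have : fderiv ℝ (fderiv ℝ u) z - (c z * f (k * L z)) • L.smulRight L =
        (fderiv ℝ c z).smulRight ((k⁻¹ * h (k * L z)) • L) +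
      (w z • fderiv ℝ (fderiv ℝ c) z +
        ((k⁻¹ * h (k * L z)) • L).smulRight (fderiv ℝ c z)) := by
      rw [hudd, mul_smul (c z) (f _)]; abel
    have hb1 : ‖(fderiv ℝ c z).smulRight ((k⁻¹ * h (k * L z)) • L)‖ ≤ d0 * (k⁻¹ * (Ch * ‖L‖)) := by
      rw [ContinuousLinearMap.norm_smulRight_apply]
      exact mul_le_mul (hd0 z) (hwdb z) (norm_nonneg _) hd0'
    have hb2 : ‖((k⁻¹ * h (k * L z)) • L).smulRight (fderiv ℝ c z)‖ ≤ k⁻¹ * (Ch * ‖L‖) * d0 := by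
      rw [ContinuousLinearMap.norm_smulRight_apply]
      exact mul_le_mul (hwdb z) (hd0 z) (norm_nonneg _) (by positivity)
    have hbd : ‖fderiv ℝ (fderiv ℝ u) z - (c z * f (k * L z)) • L.smulRight L‖ ≤ ε := by
      rw [this]
      refine (norm_add_smul_add_le hb1 (hwb z) (he0 z) hb2).trans ?_
      calc _ = k⁻¹ * M2 := by rw [hM2]; ring
        _ ≤ ε := hkM2
    have := (fderiv ℝ (fderiv ℝ u) z - (c z * f (k * L z)) • L.smulRight L).le_of_opNorm_le hbd x
    rwa [sub_apply, smul_apply, ContinuousLinearMap.smulRight_apply, smul_smul] at this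
  -- Where `c` is locally `1` all error terms vanish. This exactness is what lets the values `ξⱼ` be
  -- attained, not merely approached.
  · have hev : ∀ᶠ y in nhds z, fderiv ℝ c y = 0 := by
      filter_upwards [eventually_eventually_nhds.2 hz] with y hy
      have : c =ᶠ[nhds y] fun _ => (1 : ℝ) := hy
      rw [this.fderiv_eq]; simp
    have h0 : fderiv ℝ c z = 0 := hev.self_of_nhds
    have h1 : fderiv ℝ (fderiv ℝ c) z = 0 := by
      have : fderiv ℝ c =ᶠ[nhds z] fun _ => 0 := hev
      rw [this.fderiv_eq]; simp
    rw [hudd, h0, h1, hz.self_of_nhds]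
    simp [mul_smul]

end Oscillation

/-! ### Cutoff functions on nearly all of an open set. -/

section Cutoff

variable {E : Type*} [NormedAddCommGroup E] [NormedSpace ℝ E] [FiniteDimensional ℝ E]

lemma exists_cutoff {K G : Set E} (hK : IsCompact K) (hG : IsOpen G) (hKG : K ⊆ G) :
    ∃ c : E → ℝ, ContDiff ℝ ∞ c ∧ HasCompactSupport c ∧ tsupport c ⊆ G ∧
      (∀ z, c z ∈ Set.Icc (0 : ℝ) 1) ∧ ∀ᶠ z in nhdsSet K, c z = 1 := by
  obtain ⟨K', hK', h1, h2⟩ := exists_compact_between hK hG hKG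
  obtain ⟨c, hc1, hc0, hc⟩ := exists_contMDiffMap_one_nhds_of_subset_interior (n := ⊤)
    (modelWithCornersSelf ℝ E) hK.isClosed h1
  have hsupp : tsupport c ⊆ K' :=
    closure_minimal (fun z hz => by_contra fun h => hz (hc0 z h)) hK'.isClosed
  exact ⟨c, c.contMDiff.contDiff, hK'.of_isClosed_subset (isClosed_tsupport _) hsupp,
    hsupp.trans h2, hc, hc1⟩

/-- An open subset of `G` with compact closure in `G` that carries a cutoff function and contains
the small translates of a compact set of nearly full measure. -/
lemma exists_cutoff_nearly_full [MeasurableSpace E] [BorelSpace E] (ν : Measure E)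
    [ν.InnerRegularCompactLTTop] [IsFiniteMeasureOnCompacts ν] {G : Set E} (hG : IsOpen G)
    (hfin : ν G ≠ ⊤) {e : ℝ} (he : 0 < e) :
    ∃ (c : E → ℝ) (Ω K : Set E) (r : ℝ), ContDiff ℝ ∞ c ∧ HasCompactSupport c ∧ tsupport c ⊆ G ∧
      (∀ z, c z ∈ Set.Icc (0 : ℝ) 1) ∧ IsOpen Ω ∧ IsCompact (closure Ω) ∧ closure Ω ⊆ G ∧
      (∀ z ∈ Ω, c z = 1) ∧ 0 < r ∧ (∀ z ∈ K, ∀ v : E, ‖v‖ < r → z + v ∈ Ω) ∧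
      (1 - e) * ν.real G ≤ ν.real K := by
  obtain ⟨K, hKG, hK, hKν⟩ : ∃ K ⊆ G, IsCompact K ∧ (1 - e) * ν.real G ≤ ν.real K := by
    -- Inner regularity needs a level strictly below `ν G`, so the null case is separate.
    rcases (measureReal_nonneg (μ := ν) (s := G)).eq_or_lt with h0 | h0
    · exact ⟨∅, Set.empty_subset _, isCompact_empty, by rw [← h0]; simp⟩
    · have hlt : ENNReal.ofReal ((1 - e) * ν.real G) < ν G := by
        rw [← ENNReal.ofReal_toReal hfin]
        refine (ENNReal.ofReal_lt_ofReal_iff h0).2 ?_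
        nlinarith
      obtain ⟨K, hKG, hK, hlt'⟩ := hG.measurableSet.exists_lt_isCompact_of_ne_top hfin hlt
      refine ⟨K, hKG, hK, ?_⟩
      exact (ENNReal.ofReal_le_iff_le_toReal hK.measure_lt_top.ne).1 hlt'.le
  obtain ⟨c, hcs, hcc, hcG, hc01, hc1⟩ := exists_cutoff hK hG hKG
  obtain ⟨V, hV, hKV, hVc⟩ := eventually_nhdsSet_iff_exists.1 hc1
  have hcl : closure V ⊆ tsupport c :=
    closure_mono fun z hz => by simp [hVc z hz]
  obtain ⟨r, hr, hrV⟩ := hK.exists_thickening_subset_open hV hKV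
  refine ⟨c, V, K, r, hcs, hcc, hcG, hc01, hV, hcc.of_isClosed_subset isClosed_closure hcl,
    hcl.trans hcG, hVc, hr, fun z hz v hv => hrV ?_, hKν⟩
  exact Metric.mem_thickening_iff.2 ⟨z, hz, by simpa using hv⟩

end Cutoff

/-! ### The scalar potential for a direction of the wave cone. -/

section Potential

variable {m n : ℕ}

/-- The spatial vector `(x, 0)`. -/
def spaceVec (x : EuclideanSpace ℝ (Fin n)) : SpaceTime n := (x, 0)

/-- The unit time vector. -/
def timeVec (n : ℕ) : SpaceTime n := (0, 1)

/-- The `i`-th row of a matrix. -/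
def matRow (B : Mat m n) (i : Fin m) : EuclideanSpace ℝ (Fin n) :=
  WithLp.toLp 2 fun j => B (i, j)

lemma sum_apply_single_mul (l : SpaceTime n →L[ℝ] ℝ) (x : EuclideanSpace ℝ (Fin n)) :
    ∑ j, l (EuclideanSpace.single j 1, 0) * x j = l (spaceVec x) := by
  have hx : spaceVec x = ∑ j, x j • ((EuclideanSpace.single j 1, 0) : SpaceTime n) := by
    refine Prod.ext ?_ ?_
    · rw [Prod.fst_sum]
      ext i
      simp [spaceVec, Pi.single_apply]
    · rw [Prod.snd_sum]
      simp [spaceVec]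
  rw [hx, map_sum]
  refine Finset.sum_congr rfl fun j _ => ?_
  rw [map_smul, smul_eq_mul, mul_comm]

/-- The phase `a · x + c t`. -/
def phase (a : EuclideanSpace ℝ (Fin n)) (c : ℝ) : SpaceTime n →L[ℝ] ℝ :=
  (innerSL ℝ a).comp (ContinuousLinearMap.fst ℝ _ _) + c • ContinuousLinearMap.snd ℝ _ _

lemma phase_spaceVec (a : EuclideanSpace ℝ (Fin n)) (c : ℝ) (x : EuclideanSpace ℝ (Fin n)) :
    phase a c (spaceVec x) = inner ℝ a x := by
  simp [phase, spaceVec]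

lemma phase_timeVec (a : EuclideanSpace ℝ (Fin n)) (c : ℝ) :
    phase a c (timeVec n) = c := by
  simp [phase, timeVec]

/-- The vector `a / |a|²`. -/
def dualVec (a : EuclideanSpace ℝ (Fin n)) : EuclideanSpace ℝ (Fin n) := (‖a‖ ^ 2)⁻¹ • a

lemma inner_dualVec {a : EuclideanSpace ℝ (Fin n)} (ha : a ≠ 0) :
    inner ℝ a (dualVec a) = (1 : ℝ) := by
  have : ‖a‖ ≠ 0 := norm_ne_zero_iff.2 ha
  rw [dualVec, real_inner_smul_right, real_inner_self_eq_norm_sq]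
  field_simp

lemma inner_matRow {a : EuclideanSpace ℝ (Fin n)} {B : Mat m n} (h : matVec B a = 0)
    (i : Fin m) : inner ℝ a (matRow B i) = (0 : ℝ) := by
  have := congrArg (fun v : EuclideanSpace ℝ (Fin m) => v i) h
  simp only [matVec, PiLp.zero_apply] at this
  rw [PiLp.inner_apply]
  simpa [matRow] using this

/-- The linear map giving `φ` in terms of the gradient of a scalar potential. -/
def phiMap (p : EuclideanSpace ℝ (Fin m)) (b : EuclideanSpace ℝ (Fin n)) :
    (SpaceTime n →L[ℝ] ℝ) →L[ℝ] EuclideanSpace ℝ (Fin m) :=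
  (ContinuousLinearMap.apply ℝ ℝ (spaceVec b)).smulRight p

lemma phiMap_apply (p : EuclideanSpace ℝ (Fin m)) (b : EuclideanSpace ℝ (Fin n))
    (l : SpaceTime n →L[ℝ] ℝ) : phiMap p b l = l (spaceVec b) • p := rfl

/-- The linear map giving the divergence-free field `ψ` in terms of the gradient of a scalar
potential. -/
def psiMap (B : Mat m n) (b : EuclideanSpace ℝ (Fin n)) (c : ℝ) :
    (SpaceTime n →L[ℝ] ℝ) →L[ℝ] Mat m n where
  toFun l := WithLp.toLp 2 fun ij =>
    c⁻¹ * (B ij * l (spaceVec b) - b ij.2 * l (spaceVec (matRow B ij.1)))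
  map_add' l l' := by ext ij; simp; ring
  map_smul' r l := by ext ij; simp; ring
  cont := by fun_prop

lemma psiMap_apply (B : Mat m n) (b : EuclideanSpace ℝ (Fin n)) (c : ℝ)
    (l : SpaceTime n →L[ℝ] ℝ) (ij : Fin m × Fin n) :
    psiMap B b c l ij =
      c⁻¹ * (B ij * l (spaceVec b) - b ij.2 * l (spaceVec (matRow B ij.1))) := rfl

/-- The linear map giving `(Dφ, ∂ₜψ)` in terms of the rows of the Hessian of a scalar potential
in the spatial directions and in the time direction. -/
def pairMap (p : EuclideanSpace ℝ (Fin m)) (B : Mat m n) (b : EuclideanSpace ℝ (Fin n)) (c : ℝ) :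
    ((Fin n → SpaceTime n →L[ℝ] ℝ) × (SpaceTime n →L[ℝ] ℝ)) →L[ℝ] MatPair m n where
  toFun q := mkPair (WithLp.toLp 2 fun ij => phiMap p b (q.1 ij.2) ij.1) (psiMap B b c q.2)
  map_add' q q' := by
    refine (WithLp.equiv 2 _).injective (Prod.ext ?_ ?_)
    · ext ij; simp [mkPair]
    · simp [mkPair]
  map_smul' r q := by
    refine (WithLp.equiv 2 _).injective (Prod.ext ?_ ?_)
    · ext ij; simp [mkPair]
    · simp [mkPair]
  cont := by unfold mkPair; fun_prop

lemma pairMap_apply (p : EuclideanSpace ℝ (Fin m)) (B : Mat m n) (b : EuclideanSpace ℝ (Fin n))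
    (c : ℝ) (q : (Fin n → SpaceTime n →L[ℝ] ℝ) × (SpaceTime n →L[ℝ] ℝ)) :
    pairMap p B b c q = mkPair (WithLp.toLp 2 fun ij => phiMap p b (q.1 ij.2) ij.1)
      (psiMap B b c q.2) := rfl

/-- The rows of a bilinear form in the spatial directions and in the time direction. -/
def hessRows (Q : SpaceTime n →L[ℝ] SpaceTime n →L[ℝ] ℝ) :
    (Fin n → SpaceTime n →L[ℝ] ℝ) × (SpaceTime n →L[ℝ] ℝ) :=
  (fun j => Q (EuclideanSpace.single j 1, 0), Q (timeVec n))

/-- The rows of `l ⊗ l` in the spatial directions and in the time direction. -/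
def tensorRows (l : SpaceTime n →L[ℝ] ℝ) :
    (Fin n → SpaceTime n →L[ℝ] ℝ) × (SpaceTime n →L[ℝ] ℝ) :=
  (fun j => l (EuclideanSpace.single j 1, 0) • l, l (timeVec n) • l)

lemma norm_hessRows_sub_le {Q : SpaceTime n →L[ℝ] SpaceTime n →L[ℝ] ℝ}
    {l : SpaceTime n →L[ℝ] ℝ} {s ε : ℝ} (hε : 0 ≤ ε)
    (h : ∀ x, ‖Q x - (s * l x) • l‖ ≤ ε * ‖x‖) : ‖hessRows Q - s • tensorRows l‖ ≤ ε := by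
  refine norm_prod_le_iff.2 ⟨(pi_norm_le_iff_of_nonneg hε).2 fun j => ?_, ?_⟩
  · have := h (EuclideanSpace.single j 1, 0)
    rw [mul_smul] at this
    refine this.trans_eq ?_
    simp
  · have := h (timeVec n)
    rw [mul_smul] at this
    refine this.trans_eq ?_
    simp [timeVec]

lemma hessRows_eq {Q : SpaceTime n →L[ℝ] SpaceTime n →L[ℝ] ℝ}
    {l : SpaceTime n →L[ℝ] ℝ} {s : ℝ} (h : ∀ x, Q x = (s * l x) • l) :
    hessRows Q = s • tensorRows l := by
  refine Prod.ext (funext fun j => ?_) ?_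
  · exact (h _).trans (mul_smul _ _ _)
  · exact (h _).trans (mul_smul _ _ _)

/-- The cone condition enters here: `L (b, 0) = 1` by the choice of `b`, the rows of `B` are
orthogonal to `a`, and the time derivative of the phase is `c`, which cancels `c⁻¹`. -/
lemma pairMap_phase {p : EuclideanSpace ℝ (Fin m)} {a : EuclideanSpace ℝ (Fin n)} {B : Mat m n}
    (ha : a ≠ 0) (hB : matVec B a = 0) {c : ℝ} (hc : c ≠ 0) :
    pairMap p B (dualVec a) c (tensorRows (phase a c)) = mkPair (tensor p a) B := by
  rw [pairMap_apply]
  congr 1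
  · ext ij
    have : phase a c ((EuclideanSpace.single ij.2 1, 0) : SpaceTime n) = a ij.2 := by
      have := phase_spaceVec a c (EuclideanSpace.single ij.2 1)
      rw [spaceVec] at this
      rw [this, real_inner_comm, EuclideanSpace.inner_single_left]
      simp
    simp [phiMap_apply, phase_spaceVec, inner_dualVec ha, tensor, tensorRows, this, mul_comm]
  · ext ij
    simp [psiMap_apply, tensorRows, phase_spaceVec, phase_timeVec, inner_dualVec ha, inner_matRow hB]
    field_simp

variable {F : Type*} [NormedAddCommGroup F] [NormedSpace ℝ F] {u : SpaceTime n → ℝ}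

lemma fderiv_map_fderiv (hu : ContDiff ℝ ∞ u) (P : (SpaceTime n →L[ℝ] ℝ) →L[ℝ] F)
    (z v : SpaceTime n) :
    fderiv ℝ (fun y => P (fderiv ℝ u y)) z v = P (fderiv ℝ (fderiv ℝ u) z v) := by
  have h1 : ContDiff ℝ ∞ (fderiv ℝ u) := hu.fderiv_right (by simp)
  have h2 := P.hasFDerivAt.comp z (h1.differentiable (by simp) z).hasFDerivAt
  rw [show (fun y => P (fderiv ℝ u y)) = P ∘ fderiv ℝ u from rfl, h2.fderiv]
  rfl

lemma isTestFunction_map_fderiv {G : Set (SpaceTime n)} (hu : IsTestFunction G u)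
    (P : (SpaceTime n →L[ℝ] ℝ) →L[ℝ] F) : IsTestFunction G fun y => P (fderiv ℝ u y) := by
  have h1 : ContDiff ℝ ∞ (fderiv ℝ u) := hu.smooth.fderiv_right (by simp)
  have hsub : tsupport (fun y => P (fderiv ℝ u y)) ⊆ tsupport u :=
    (tsupport_comp_subset (map_zero P) _).trans (tsupport_fderiv_subset ℝ)
  exact ⟨P.contDiff.comp h1, hu.compact_support.of_isClosed_subset (isClosed_tsupport _) hsub,
    hsub.trans hu.support_subset⟩

lemma isTestFunction_smul_const {G : Set (SpaceTime n)} (hu : IsTestFunction G u) (M : F) :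
    IsTestFunction G fun y => u y • M := by
  have hsub : tsupport (fun y => u y • M) ⊆ tsupport u :=
    closure_mono fun z hz h => hz (by simp [h])
  exact ⟨hu.smooth.smul contDiff_const,
    hu.compact_support.of_isClosed_subset (isClosed_tsupport _) hsub,
    hsub.trans hu.support_subset⟩

lemma fderiv_smul_const_apply (hu : ContDiff ℝ ∞ u) (M : F) (z v : SpaceTime n) :
    fderiv ℝ (fun y => u y • M) z v = fderiv ℝ u z v • M := by
  rw [((hu.differentiable (by simp) z).hasFDerivAt.smul_const M).fderiv]
  rfl

lemma mkPair_potential (hu : ContDiff ℝ ∞ u) (p : EuclideanSpace ℝ (Fin m)) (B : Mat m n)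
    (b : EuclideanSpace ℝ (Fin n)) (c : ℝ) (z : SpaceTime n) :
    mkPair (spaceGrad (fun y => phiMap p b (fderiv ℝ u y)) z)
      (dTime (fun y => psiMap B b c (fderiv ℝ u y)) z) =
      pairMap p B b c (hessRows (fderiv ℝ (fderiv ℝ u) z)) := by
  rw [pairMap_apply]
  simp only [spaceGrad, dSpace, dTime, fderiv_map_fderiv hu, timeVec, hessRows]

/-- The two terms contract the Hessian with `b` and the row `B_i` in opposite orders, and cancel by
symmetry. -/
lemma spaceDiv_psiMap (hu : ContDiff ℝ ∞ u) (B : Mat m n)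
    (b : EuclideanSpace ℝ (Fin n)) (c : ℝ) (z : SpaceTime n) :
    spaceDiv (fun y => psiMap B b c (fderiv ℝ u y)) z = 0 := by
  have hsymm : ∀ v w, fderiv ℝ (fderiv ℝ u) z v w = fderiv ℝ (fderiv ℝ u) z w v :=
    fun v w => ((contDiff_infty.1 hu 2).contDiffAt.isSymmSndFDerivAt (by simp)).eq v w
  ext i
  simp only [spaceDiv, dSpace, fderiv_map_fderiv hu, psiMap_apply, PiLp.zero_apply]
  rw [← Finset.mul_sum, Finset.sum_sub_distrib]
  have h1 := sum_apply_single_mul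
    ((fderiv ℝ (fderiv ℝ u) z).flip (spaceVec b)) (matRow B i)
  have h2 := sum_apply_single_mul
    ((fderiv ℝ (fderiv ℝ u) z).flip (spaceVec (matRow B i))) b
  simp only [ContinuousLinearMap.flip_apply, matRow] at h1 h2
  have h3 := hsymm (spaceVec (matRow B i)) (spaceVec b)
  simp only [matRow] at h3 ⊢
  simp only [mul_comm (B _), mul_comm (b _)]
  rw [h1, h2, h3, sub_self, mul_zero]

lemma spaceDiv_smul_tensor (hu : ContDiff ℝ ∞ u) (p : EuclideanSpace ℝ (Fin m))
    (b : EuclideanSpace ℝ (Fin n)) (z : SpaceTime n) :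
    spaceDiv (fun y => u y • tensor p b) z = phiMap p b (fderiv ℝ u z) := by
  ext i
  simp only [spaceDiv, dSpace, fderiv_smul_const_apply hu, phiMap_apply, PiLp.smul_apply,
    tensor, smul_eq_mul]
  rw [← sum_apply_single_mul, Finset.sum_mul]
  exact Finset.sum_congr rfl fun j _ => by ring

end Potential

/-! ### Splitting along one cone direction. -/

section Splitting

variable {m n : ℕ}

/-- Given an amplitude `γ` in the wave cone, there are compactly supported fields for which
`(Dφ, ∂ₜψ)` oscillates between `(1 - l) γ` and `-l γ` in the proportions `l : 1 - l`. -/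
lemma exists_splitting {γ : MatPair m n} (hγ : γ ∈ waveCone m n) {l : ℝ} (hl0 : 0 ≤ l)
    (hl1 : l ≤ 1) {G : Set (SpaceTime n)} (hG : IsOpen G) (hGb : Bornology.IsBounded G)
    {δ : ℝ} (hδ : 0 < δ) :
    ∃ (φ : SpaceTime n → EuclideanSpace ℝ (Fin m)) (ψ g : SpaceTime n → Mat m n),
      IsTestFunction G φ ∧ IsTestFunction G ψ ∧ IsTestFunction G g ∧
      (∀ z, spaceDiv ψ z = 0 ∧ spaceDiv g z = φ z ∧ ∃ s ∈ Set.Icc (-l) (1 - l),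
        ‖mkPair (spaceGrad φ z) (dTime ψ z) - s • γ‖ < δ) ∧
      (∀ z, ‖φ z‖ < δ ∧ ‖dTime φ z‖ < δ ∧ ‖dTime g z‖ < δ) ∧
      ∃ U V : Set (SpaceTime n), Disjoint U V ∧
        (IsOpen U ∧ IsCompact (closure U) ∧ closure U ⊆ G ∧
          (∀ z ∈ U, mkPair (spaceGrad φ z) (dTime ψ z) = (1 - l) • γ) ∧
          (l - δ) * volume.real G ≤ volume.real U) ∧
        (IsOpen V ∧ IsCompact (closure V) ∧ closure V ⊆ G ∧
          (∀ z ∈ V, mkPair (spaceGrad φ z) (dTime ψ z) = (-l) • γ) ∧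
          (1 - l - δ) * volume.real G ≤ volume.real V) := by
  obtain ⟨p, a, B, ha, hB, rfl⟩ := hγ
  have hGfin : volume G ≠ ⊤ := hGb.measure_lt_top.ne
  obtain ⟨f, h, H, hHs, hH, hh, hHb, hhb, hf, ⟨α₁, β₁, hα₁, hβ₁, hlen₁, hf₁⟩,
    ⟨α₂, β₂, hα₂, hβ₂, hlen₂, hf₂⟩⟩ := exists_profile hl0 hl1 (half_pos hδ)
  obtain ⟨χ, Ω, K, r, hχs, hχc, hχG, hχ01, hΩ, hΩc, hΩG, hχ1, hr, hKΩ, hKm⟩ :=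
    exists_cutoff_nearly_full volume hG hGfin (half_pos hδ)
  -- A slow time frequency makes the leading part `s c p` of `∂ₜφ` small; it must be nonzero because
  -- `ψ` contains `c⁻¹`.
  set c : ℝ := δ / 2 / (‖p‖ + 1) with hc
  have hp1 : 0 < ‖p‖ + 1 := by positivity
  have hc0 : 0 < c := by positivity
  have hcp : c * ‖p‖ < δ / 2 := by
    rw [hc, div_mul_eq_mul_div, div_lt_iff₀ hp1]
    linarith
  set b := dualVec a with hb
  set L := phase a c with hL
  set P := phiMap p b with hP
  set R := psiMap B b c with hR
  set T := pairMap p B b c with hT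
  set M : Mat m n := tensor p b with hM
  set C : ℝ := ‖T‖ + ‖P‖ + ‖M‖ + 1 with hC
  have hC0 : 0 < C := by positivity
  set ε : ℝ := δ / 2 / C with hε
  have hε0 : 0 < ε := by positivity
  have hεC : C * ε = δ / 2 := by rw [hε]; field_simp
  have hTε : ‖T‖ * ε ≤ δ / 2 := by
    rw [← hεC]; gcongr; rw [hC]; linarith [norm_nonneg P, norm_nonneg M]
  have hPε : ‖P‖ * ε ≤ δ / 2 := by
    rw [← hεC]; gcongr; rw [hC]; linarith [norm_nonneg T, norm_nonneg M]
  have hMε : ‖M‖ * ε ≤ δ / 2 := by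
    rw [← hεC]; gcongr; rw [hC]; linarith [norm_nonneg T, norm_nonneg P]
  have hLb : L (spaceVec b) = 1 := by rw [hL, phase_spaceVec, inner_dualVec ha]
  have hLt : L (timeVec n) = c := phase_timeVec a c
  have hTL : T (tensorRows L) = mkPair (tensor p a) B := pairMap_phase ha hB hc0.ne'
  have hPL : P L = p := by rw [hP, phiMap_apply, hLb, one_smul]
  have ht1 : ‖timeVec n‖ = 1 := by simp [timeVec]
  obtain ⟨k₀, hk₀⟩ := exists_oscillation hχs hχc hHs hH hh hHb hhb L hε0
  -- The last bound makes `k⁻¹ b`, which advances the phase `k L` by one period, shorter than `r`,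
  -- so that translates of `K` stay in `Ω`.
  obtain ⟨k, hk⟩ := exists_gt (max (max k₀ 0) (‖spaceVec b‖ / r))
  have hk1 : k₀ < k := (le_max_left _ _).trans_lt ((le_max_left _ _).trans_lt hk)
  have hk2 : 0 < k := (le_max_right _ _).trans_lt ((le_max_left _ _).trans_lt hk)
  have hk3 : ‖spaceVec b‖ < k * r := (div_lt_iff₀ hr).1 ((le_max_right _ _).trans_lt hk)
  obtain ⟨u, hus, husupp, hu1, hu2, hu3⟩ := hk₀ k hk1
  have hut : IsTestFunction G u :=
    ⟨hus, hχc.of_isClosed_subset (isClosed_tsupport _) husupp, husupp.trans hχG⟩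
  have hpair := fun z => mkPair_potential hus p B b c z
  -- Damping by `χ` moves the value of `f` towards `0`, which lies in the same interval.
  have hs : ∀ z, χ z * f (k * L z) ∈ Set.Icc (-l) (1 - l) := fun z => by
    obtain ⟨h1, h2⟩ := hf (k * L z)
    obtain ⟨h3, h4⟩ := hχ01 z
    constructor
    · linarith [mul_nonneg h3 (by linarith : 0 ≤ f (k * L z) + l),
        mul_nonneg (sub_nonneg.2 h4) hl0]
    · linarith [mul_nonneg h3 (sub_nonneg.2 h2),
        mul_nonneg (sub_nonneg.2 h4) (sub_nonneg.2 hl1)]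
  have hs1 : ∀ z, |χ z * f (k * L z)| ≤ 1 := fun z =>
    abs_le.2 ⟨by linarith [(hs z).1], by linarith [(hs z).2]⟩
  have hinv : (volume : Measure (SpaceTime n)).IsAddRightInvariant := by
    change ((volume : Measure (EuclideanSpace ℝ (Fin n))).prod
      (volume : Measure ℝ)).IsAddRightInvariant
    infer_instance
  -- Half of `δ` pays for the ramps of the profile, half for the part of `G` outside `K`.
  have hmeas : ∀ α β : ℝ, 0 ≤ α → β ≤ 1 → ∀ q, q - δ / 2 ≤ β - α → q ≤ 1 →
      (q - δ) * volume.real G ≤ volume.real (Ω ∩ {z | Int.fract ((k • L) z) ∈ Set.Ioo α β}) := by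
    intro α β hα hβ q hq hq1
    have hv : (k • L) (k⁻¹ • spaceVec b) = 1 := by
      simp [hLb, hk2.ne']
    have hΩG' : Ω ⊆ G := subset_closure.trans hΩG
    have hΩfin : volume Ω ≠ ⊤ := ne_top_of_le_ne_top hGfin (measure_mono hΩG')
    have hKG : volume.real K ≤ volume.real G := measureReal_mono
      (fun z hz => hΩG' (by simpa using hKΩ z hz 0 (by simpa using hr))) hGfin
    have h1 := volume_inter_fract_ge volume (k • L) hv (K := K) hΩfin (fun σ hσ z hz => by
      refine hKΩ z hz _ ?_
      rw [norm_smul, norm_smul, Real.norm_of_nonneg hσ.1,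
        Real.norm_of_nonneg (inv_nonneg.2 hk2.le)]
      have h2 : k⁻¹ * ‖spaceVec b‖ < r := (inv_mul_lt_iff₀ hk2).2 hk3
      have h3 : 0 ≤ k⁻¹ * ‖spaceVec b‖ := by positivity
      exact (mul_le_of_le_one_left h3 hσ.2).trans_lt h2) hα hβ
    refine le_trans ?_ h1
    have hG0 : 0 ≤ volume.real G := measureReal_nonneg
    have hK0 : 0 ≤ volume.real K := measureReal_nonneg
    have h4 : (q - δ / 2) * volume.real K ≤ (β - α) * volume.real K :=
      mul_le_mul_of_nonneg_right hq hK0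
    refine le_trans ?_ h4
    rcases le_total 0 q with hq0 | hq0
    · linarith [mul_le_mul_of_nonneg_left hKm hq0,
        mul_nonneg (half_pos hδ).le (sub_nonneg.2 hKG),
        mul_nonneg (mul_nonneg (half_pos hδ).le (sub_nonneg.2 hq1)) hG0]
    · linarith [mul_nonneg (by linarith : 0 ≤ δ / 2 - q) (sub_nonneg.2 hKG),
        mul_nonneg hδ.le hG0]
  have hopen : ∀ α β : ℝ, 0 ≤ α → β ≤ 1 →
      IsOpen (Ω ∩ {z | Int.fract ((k • L) z) ∈ Set.Ioo α β}) := fun α β hα hβ =>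
    hΩ.inter ((isOpen_fract_preimage_Ioo hα hβ).preimage (k • L).continuous)
  have hcl : ∀ α β : ℝ, closure (Ω ∩ {z | Int.fract ((k • L) z) ∈ Set.Ioo α β}) ⊆ closure Ω :=
    fun α β => closure_mono Set.inter_subset_left
  have hval : ∀ z ∈ Ω, mkPair (spaceGrad (fun y => P (fderiv ℝ u y)) z)
      (dTime (fun y => R (fderiv ℝ u y)) z) = f (k * L z) • mkPair (tensor p a) B := by
    intro z hz
    have h1 : ∀ᶠ y in nhds z, χ y = 1 := Filter.eventually_of_mem (hΩ.mem_nhds hz) hχ1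
    rw [hpair, hessRows_eq (hu3 z h1), ← hTL, map_smul]
  refine ⟨fun y => P (fderiv ℝ u y), fun y => R (fderiv ℝ u y), fun y => u y • M,
    isTestFunction_map_fderiv hut P, isTestFunction_map_fderiv hut R,
    isTestFunction_smul_const hut M,
    fun z => ⟨spaceDiv_psiMap hus B b c z, spaceDiv_smul_tensor hus p b z, _, hs z, ?_⟩,
    fun z => ⟨?_, ?_, ?_⟩,
    Ω ∩ {z | Int.fract ((k • L) z) ∈ Set.Ioo α₁ β₁},
    Ω ∩ {z | Int.fract ((k • L) z) ∈ Set.Ioo α₂ β₂}, ?_,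
    ⟨hopen _ _ hα₁ hβ₁, hΩc.of_isClosed_subset isClosed_closure (hcl _ _),
      (hcl _ _).trans hΩG, fun z hz => ?_, hmeas _ _ hα₁ hβ₁ _ hlen₁ hl1⟩,
    ⟨hopen _ _ hα₂ hβ₂, hΩc.of_isClosed_subset isClosed_closure (hcl _ _),
      (hcl _ _).trans hΩG, fun z hz => ?_, hmeas _ _ hα₂ hβ₂ _ hlen₂ (by linarith)⟩⟩
  · rw [hpair, ← hTL, ← map_smul, ← map_sub]
    calc _ ≤ ‖T‖ * ε := T.le_opNorm_of_le (norm_hessRows_sub_le hε0.le (hu2 z))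
      _ < δ := by linarith
  · calc _ ≤ ‖P‖ * ε := P.le_opNorm_of_le (hu1 z)
      _ < δ := by linarith
  · set q := fderiv ℝ (fderiv ℝ u) z (timeVec n) with hq
    set s := χ z * f (k * L z) with hsdef
    have h1 : dTime (fun y => P (fderiv ℝ u y)) z = P (q - (s * c) • L) + (s * c) • p := by
      rw [dTime, fderiv_map_fderiv hus, map_sub, map_smul, hPL, sub_add_cancel]
      rfl
    have h3 : ‖q - (s * c) • L‖ ≤ ε := by
      have := hu2 z (timeVec n)
      rwa [ht1, mul_one, hLt] at this
    rw [h1]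
    calc _ ≤ ‖P‖ * ε + |s| * c * ‖p‖ := by
          refine (norm_add_le _ _).trans (add_le_add (P.le_opNorm_of_le h3) ?_)
          rw [norm_smul, norm_mul, Real.norm_eq_abs, Real.norm_of_nonneg hc0.le]
      _ ≤ δ / 2 + c * ‖p‖ := by
          refine add_le_add hPε ?_
          rw [mul_assoc]
          exact mul_le_of_le_one_left (by positivity) (hs1 z)
      _ < δ := by linarith
  · rw [dTime, fderiv_smul_const_apply hus, norm_smul]
    have h1 : ‖fderiv ℝ u z (timeVec n)‖ ≤ ε := by
      have := (fderiv ℝ u z).le_of_opNorm_le (hu1 z) (timeVec n)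
      rwa [ht1, mul_one] at this
    calc _ ≤ ε * ‖M‖ := mul_le_mul_of_nonneg_right h1 (norm_nonneg _)
      _ < δ := by linarith
  · refine Set.disjoint_left.2 fun z hz₁ hz₂ => ?_
    linarith [hf₁ _ hz₁.2, hf₂ _ hz₂.2]
  · rw [hval z hz.1]
    congr 1
    exact hf₁ _ hz.2
  · rw [hval z hz.1]
    congr 1
    exact hf₂ _ hz.2

end Splitting

/-! ### Approximable points and the iteration step. -/

section Approximation

variable {m n N : ℕ} {F : Type*} [NormedAddCommGroup F] [NormedSpace ℝ F]

lemma isTestFunction_zero (G : Set (SpaceTime n)) :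
    IsTestFunction G (fun _ => (0 : F)) :=
  ⟨contDiff_const, HasCompactSupport.zero, by simp [tsupport]⟩

lemma IsTestFunction.mono {G G' : Set (SpaceTime n)} {f : SpaceTime n → F}
    (hf : IsTestFunction G f) (h : G ⊆ G') : IsTestFunction G' f :=
  ⟨hf.smooth, hf.compact_support, hf.support_subset.trans h⟩

lemma IsTestFunction.add {G : Set (SpaceTime n)} {f f' : SpaceTime n → F}
    (hf : IsTestFunction G f) (hf' : IsTestFunction G f') :
    IsTestFunction G (fun z => f z + f' z) :=
  ⟨hf.smooth.add hf'.smooth, hf.compact_support.add hf'.compact_support,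
    (tsupport_add f f').trans (Set.union_subset hf.support_subset hf'.support_subset)⟩

lemma IsTestFunction.fderiv_add {G : Set (SpaceTime n)} {f f' : SpaceTime n → F}
    (hf : IsTestFunction G f) (hf' : IsTestFunction G f') (z : SpaceTime n) :
    fderiv ℝ (fun z => f z + f' z) z = fderiv ℝ f z + fderiv ℝ f' z :=
  fderiv_fun_add (hf.smooth.differentiable (by simp) z) (hf'.smooth.differentiable (by simp) z)

lemma IsTestFunction.fderiv_eq_zero {G : Set (SpaceTime n)} {f : SpaceTime n → F}
    (hf : IsTestFunction G f) {z : SpaceTime n} (hz : z ∉ G) : fderiv ℝ f z = 0 :=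
  fderiv_of_notMem_tsupport ℝ fun h => hz (hf.support_subset h)

lemma IsTestFunction.dTime_add {G : Set (SpaceTime n)} {f f' : SpaceTime n → F}
    (hf : IsTestFunction G f) (hf' : IsTestFunction G f') (z : SpaceTime n) :
    dTime (fun z => f z + f' z) z = dTime f z + dTime f' z := by
  simp only [dTime, hf.fderiv_add hf', add_apply]

lemma IsTestFunction.spaceDiv_add {G : Set (SpaceTime n)} {f f' : SpaceTime n → Mat m n}
    (hf : IsTestFunction G f) (hf' : IsTestFunction G f') (z : SpaceTime n) :
    spaceDiv (fun z => f z + f' z) z = spaceDiv f z + spaceDiv f' z := by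
  ext i
  simp [spaceDiv, dSpace, hf.fderiv_add hf', Finset.sum_add_distrib]

lemma IsTestFunction.spaceGrad_add {G : Set (SpaceTime n)}
    {f f' : SpaceTime n → EuclideanSpace ℝ (Fin m)}
    (hf : IsTestFunction G f) (hf' : IsTestFunction G f') (z : SpaceTime n) :
    spaceGrad (fun z => f z + f' z) z = spaceGrad f z + spaceGrad f' z := by
  ext ij
  simp [spaceGrad, dSpace, hf.fderiv_add hf']

lemma mkPair_add (A A' B B' : Mat m n) :
    mkPair (A + A') (B + B') = mkPair A B + mkPair A' B' := rfl

lemma mkPair_zero : mkPair (0 : Mat m n) 0 = 0 := rfl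

lemma mkPair_eq_zero {G G' : Set (SpaceTime n)} {φ : SpaceTime n → EuclideanSpace ℝ (Fin m)}
    {ψ : SpaceTime n → Mat m n} (hφ : IsTestFunction G φ) (hψ : IsTestFunction G' ψ)
    {z : SpaceTime n} (hz : z ∉ G) (hz' : z ∉ G') :
    mkPair (spaceGrad φ z) (dTime ψ z) = 0 := by
  have h1 : spaceGrad φ z = 0 := by
    ext ij
    simp [spaceGrad, dSpace, hφ.fderiv_eq_zero hz]
  rw [h1, dTime, hψ.fderiv_eq_zero hz']
  exact mkPair_zero

lemma smul_mem_waveCone {γ : MatPair m n} (hγ : γ ∈ waveCone m n) (r : ℝ) :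
    r • γ ∈ waveCone m n := by
  obtain ⟨p, a, B, ha, hB, rfl⟩ := hγ
  refine ⟨r • p, a, r • B, ha, ?_, ?_⟩
  · ext i
    have := congrArg (fun v : EuclideanSpace ℝ (Fin m) => v i) hB
    simp only [matVec, PiLp.zero_apply] at this
    simp [matVec, mul_assoc, ← Finset.mul_sum, this]
  · have : tensor (r • p) a = r • tensor p a := by
      ext ij
      simp [tensor, mul_assoc]
    rw [this]
    rfl

/-- `η` can be approximated by compactly supported fields whose values stay near `S`, and which
take each value `ξ j` on a set of volume fraction nearly `w j`. -/
def Approximable (S : Set (MatPair m n)) (ξ : Fin N → MatPair m n) (η : MatPair m n)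
    (w : Fin N → ℝ) : Prop :=
  ∀ G : Set (SpaceTime n), IsOpen G → Bornology.IsBounded G → ∀ δ : ℝ, 0 < δ →
    ∃ (φ : SpaceTime n → EuclideanSpace ℝ (Fin m)) (ψ g : SpaceTime n → Mat m n),
      IsTestFunction G φ ∧ IsTestFunction G ψ ∧ IsTestFunction G g ∧
      (∀ z, spaceDiv ψ z = 0 ∧ spaceDiv g z = φ z ∧
        η + mkPair (spaceGrad φ z) (dTime ψ z) ∈ Metric.thickening δ S) ∧
      (∀ z, ‖φ z‖ < δ ∧ ‖dTime φ z‖ < δ ∧ ‖dTime g z‖ < δ) ∧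
      ∃ U : Fin N → Set (SpaceTime n),
        (∀ j k, j ≠ k → Disjoint (U j) (U k)) ∧
        ∀ j, IsOpen (U j) ∧ IsCompact (closure (U j)) ∧ closure (U j) ⊆ G ∧
          (∀ z ∈ U j, η + mkPair (spaceGrad φ z) (dTime ψ z) = ξ j) ∧
          (w j - δ) * volume.real G ≤ volume.real (U j)

variable {S : Set (MatPair m n)} {ξ : Fin N → MatPair m n} {η : MatPair m n} {w : Fin N → ℝ}

lemma Approximable.mono {w' : Fin N → ℝ} (h : Approximable S ξ η w) (hw : ∀ j, w' j ≤ w j) :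
    Approximable S ξ η w' := by
  intro G hG hGb δ hδ
  obtain ⟨φ, ψ, g, hφ, hψ, hg, h1, h2, U, hU, h3⟩ := h G hG hGb δ hδ
  refine ⟨φ, ψ, g, hφ, hψ, hg, h1, h2, U, hU, fun j => ?_⟩
  obtain ⟨h4, h5, h6, h7, h8⟩ := h3 j
  exact ⟨h4, h5, h6, h7, le_trans
    (mul_le_mul_of_nonneg_right (by linarith [hw j]) measureReal_nonneg) h8⟩

/-- Zero fields and empty sets suffice; this starts the induction. -/
lemma approximable_of_nonpos (hη : η ∈ S) (hw : ∀ j, w j ≤ 0) : Approximable S ξ η w := by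
  intro G hG hGb δ hδ
  have hpair : ∀ z : SpaceTime n, mkPair
      (spaceGrad (fun _ => (0 : EuclideanSpace ℝ (Fin m))) z)
      (dTime (fun _ : SpaceTime n => (0 : Mat m n)) z) = 0 := fun z =>
    mkPair_eq_zero (isTestFunction_zero ∅) (isTestFunction_zero ∅) (by simp) (by simp)
  have hdiv : ∀ z : SpaceTime n, spaceDiv (fun _ => (0 : Mat m n)) z = 0 := fun z => by
    ext i
    simp [spaceDiv, dSpace]
  refine ⟨fun _ => 0, fun _ => 0, fun _ => 0, isTestFunction_zero G, isTestFunction_zero G,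
    isTestFunction_zero G, fun z => ⟨hdiv z, hdiv z, ?_⟩, fun z => by simp [dTime, hδ],
    fun _ => ∅, by simp, fun j => ⟨isOpen_empty, by simp, by simp, by simp, ?_⟩⟩
  · rw [hpair, add_zero]
    exact Metric.self_subset_thickening hδ S hη
  · rw [measureReal_empty]
    exact mul_nonpos_of_nonpos_of_nonneg (by linarith [hw j]) measureReal_nonneg

/-- Splitting along a rank-one connection, followed by an approximation of one of the two
endpoints. -/
lemma Approximable.segment {π : MatPair m n} (h : Approximable S ξ π w)
    (hw : ∀ j, |w j| ≤ 1) {i : Fin N} (hcone : ξ i - π ∈ waveCone m n)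
    (hseg : segment ℝ (ξ i) π ⊆ S) {l : ℝ} (hl0 : 0 ≤ l) (hl1 : l ≤ 1) :
    Approximable S ξ (l • ξ i + (1 - l) • π)
      (fun j => (if j = i then l else 0) + (1 - l) * w j) := by
  intro G hG hGb δ hδ
  have hd : 0 < δ / 4 := by linarith
  obtain ⟨φ, ψ, g, hφ, hψ, hg, hdiv, hsmall, U, V, hUV, ⟨hUo, hUc, hUG, hUval, hUm⟩,
    ⟨hVo, hVc, hVG, hVval, hVm⟩⟩ := exists_splitting hcone hl0 hl1 hG hGb hd
  have hVG' : V ⊆ G := subset_closure.trans hVG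
  have hUG' : U ⊆ G := subset_closure.trans hUG
  -- On `V` the first field brings the value exactly to `π`, so `V` itself serves as the domain for
  -- approximating `π`.
  obtain ⟨φ', ψ', g', hφ', hψ', hg', hdiv', hsmall', W, hW, hWj⟩ :=
    h V hVo (hGb.subset hVG') (δ / 4) hd
  have hWV : ∀ j, W j ⊆ V := fun j => subset_closure.trans (hWj j).2.2.1
  have hφG := hφ'.mono hVG'
  have hψG := hψ'.mono hVG'
  have hgG := hg'.mono hVG'
  have hpair : ∀ z, mkPair (spaceGrad (fun z => φ z + φ' z) z) (dTime (fun z => ψ z + ψ' z) z) =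
      mkPair (spaceGrad φ z) (dTime ψ z) + mkPair (spaceGrad φ' z) (dTime ψ' z) := fun z => by
    rw [hφ.spaceGrad_add hφG, hψ.dTime_add hψG, mkPair_add]
  have hin : ∀ z ∈ V, l • ξ i + (1 - l) • π + mkPair (spaceGrad (fun z => φ z + φ' z) z)
      (dTime (fun z => ψ z + ψ' z) z) = π + mkPair (spaceGrad φ' z) (dTime ψ' z) := fun z hz => by
    rw [hpair, hVval z hz]
    module
  have hout : ∀ z ∉ V, mkPair (spaceGrad (fun z => φ z + φ' z) z)
      (dTime (fun z => ψ z + ψ' z) z) = mkPair (spaceGrad φ z) (dTime ψ z) := fun z hz => by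
    rw [hpair, mkPair_eq_zero hφ' hψ' hz hz, add_zero]
  have hUdisj : ∀ j, Disjoint U (W j) := fun j => hUV.mono_right (hWV j)
  refine ⟨fun z => φ z + φ' z, fun z => ψ z + ψ' z, fun z => g z + g' z, hφ.add hφG, hψ.add hψG,
    hg.add hgG, fun z => ⟨?_, ?_, ?_⟩, fun z => ⟨?_, ?_, ?_⟩,
    fun j => if j = i then U ∪ W j else W j, fun j k hjk => ?_, fun j => ?_⟩
  · rw [hψ.spaceDiv_add hψG, (hdiv z).1, (hdiv' z).1, add_zero]
  · rw [hg.spaceDiv_add hgG, (hdiv z).2.1, (hdiv' z).2.1]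
  · by_cases hz : z ∈ V
    · rw [hin z hz]
      exact Metric.thickening_mono (by linarith) S (hdiv' z).2.2
    · rw [hout z hz]
      obtain ⟨s, hs, hlt⟩ := (hdiv z).2.2
      -- The nearby point has parameter `l + s` on the segment, and `-l ≤ s ≤ 1 - l`.
      refine Metric.mem_thickening_iff.2 ⟨l • ξ i + (1 - l) • π + s • (ξ i - π), hseg ?_, ?_⟩
      · refine ⟨l + s, 1 - l - s, by linarith [hs.1], by linarith [hs.2], by ring, ?_⟩
        module
      · rw [dist_eq_norm, add_sub_add_left_eq_sub]
        linarith
  · exact (norm_add_le _ _).trans_lt (by linarith [(hsmall z).1, (hsmall' z).1])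
  · rw [hφ.dTime_add hφG]
    exact (norm_add_le _ _).trans_lt (by linarith [(hsmall z).2.1, (hsmall' z).2.1])
  · rw [hg.dTime_add hgG]
    exact (norm_add_le _ _).trans_lt (by linarith [(hsmall z).2.2, (hsmall' z).2.2])
  · by_cases hj : j = i <;> by_cases hk : k = i
    · exact absurd (hj.trans hk.symm) hjk
    · simp only [if_pos hj, if_neg hk]
      exact Set.disjoint_union_left.2 ⟨hUdisj k, hW j k hjk⟩
    · simp only [if_neg hj, if_pos hk]
      exact Set.disjoint_union_right.2 ⟨(hUdisj j).symm, hW j k hjk⟩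
    · simp only [if_neg hj, if_neg hk]
      exact hW j k hjk
  · obtain ⟨hWo, hWc, hWcl, hWval, hWm⟩ := hWj j
    have hWval' : ∀ z ∈ W j, l • ξ i + (1 - l) • π + mkPair (spaceGrad (fun z => φ z + φ' z) z)
        (dTime (fun z => ψ z + ψ' z) z) = ξ j := fun z hz => by
      rw [hin z (hWV j hz), hWval z hz]
    have hGfin : volume G ≠ ⊤ := hGb.measure_lt_top.ne
    have hsum : volume.real U + volume.real V ≤ volume.real G := by
      rw [← measureReal_union hUV hVo.measurableSet
        (ne_top_of_le_ne_top hGfin (measure_mono hUG'))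
        (ne_top_of_le_ne_top hGfin (measure_mono hVG'))]
      exact measureReal_mono (Set.union_subset hUG' hVG') hGfin
    have hG0 : 0 ≤ volume.real G := measureReal_nonneg
    have hU0 : 0 ≤ volume.real U := measureReal_nonneg
    have hm : ((1 - l) * w j - 3 * (δ / 4)) * volume.real G ≤ volume.real (W j) := by
      refine le_trans ?_ hWm
      obtain ⟨h1, h2⟩ := abs_le.1 (hw j)
      have e1 : 0 ≤ δ / 4 * (volume.real G - volume.real V) :=
        mul_nonneg hd.le (by linarith)
      have hdG : 0 ≤ δ / 4 * volume.real G := mul_nonneg hd.le hG0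
      -- For `w j ≥ 0` this uses the lower bound on the measure of `V`. Negative weights need an
      -- upper bound, supplied by disjointness from `U`.
      have e2 : (1 - l) * w j * volume.real G - δ / 4 * volume.real G ≤ w j * volume.real V := by
        rcases le_total 0 (w j) with h0 | h0
        · linarith [mul_le_mul_of_nonneg_left hVm h0, mul_nonneg (sub_nonneg.2 h2) hdG]
        · have hV2 : volume.real V ≤ (1 - l + δ / 4) * volume.real G := by linarith
          linarith [mul_le_mul_of_nonpos_left hV2 h0,
            mul_nonneg (by linarith : 0 ≤ 1 + w j) hdG]
      linarith
    by_cases hj : j = i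
    · simp only [if_pos hj]
      refine ⟨hUo.union hWo, ?_, ?_, fun z hz => ?_, ?_⟩
      · rw [closure_union]; exact hUc.union hWc
      · rw [closure_union]; exact Set.union_subset hUG (hWcl.trans hVG')
      · rcases hz with hz | hz
        · rw [hout z (Set.disjoint_left.1 hUV hz), hUval z hz, hj]
          module
        · exact hWval' z hz
      · rw [measureReal_union (hUdisj j) hWo.measurableSet
          (ne_top_of_le_ne_top hGfin (measure_mono hUG'))
          (ne_top_of_le_ne_top hGfin (measure_mono ((hWV j).trans hVG')))]
        linarith
    · simp only [if_neg hj]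
      refine ⟨hWo, hWc, hWcl.trans hVG', hWval', ?_⟩
      linarith [mul_nonneg hd.le hG0]

end Approximation

/-! ### Iteration around the configuration. -/

section Configuration

variable {m n N : ℕ} {ξ : Fin N → MatPair m n} {ρ : MatPair m n} {γ : Fin N → MatPair m n}
  {κ : Fin N → ℝ}

namespace IsTNConfigurationWith

lemma sub_vertex_mem_waveCone (hξ : IsTNConfigurationWith ξ ρ γ κ) (i : Fin N) :
    ξ i - vertex ρ γ i ∈ waveCone m n := by
  rw [hξ.eq_add i, add_sub_cancel_left]
  exact smul_mem_waveCone (hξ.mem_waveCone i) _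

/-- The exponent `r` counts splittings. Each one multiplies the deficit in the weights by some `1 -
1 / κ k`, which is at most `q`. -/
lemma approximable_vertex (hξ : IsTNConfigurationWith ξ ρ γ κ) {q : ℝ} (hq0 : 0 ≤ q)
    (hq1 : q ≤ 1) (hq : ∀ k, 1 - 1 / κ k ≤ q) (r : ℕ) (i : Fin N) :
    Approximable (configSet ξ ρ γ) ξ (vertex ρ γ i)
      (fun j => cyclicCoeff (fun k => 1 / κ k) i j - q ^ r) := by
  induction r generalizing i with
  | zero =>
    -- With `r = 0` the deficit is `1`, which already makes every weight nonpositive.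
    refine approximable_of_nonpos (Set.mem_iUnion.2 ⟨i, right_mem_segment ℝ _ _⟩) fun j => ?_
    rw [pow_zero]
    linarith [cyclicCoeff_le_one hξ.inv_pos hξ.inv_lt_one i j]
  | succ r ih =>
    obtain ⟨k, hk⟩ := exists_isCyclicPred i
    have hD : 1 - ∏ k, (1 - 1 / κ k) ≠ 0 := by
      linarith [prod_one_sub_lt_one hξ.inv_pos hξ.inv_lt_one i]
    rw [hξ.vertex_eq hk]
    refine ((ih k).segment (fun j => abs_le.2 ⟨?_, ?_⟩) (hξ.sub_vertex_mem_waveCone k)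
      (Set.subset_iUnion (fun j => segment ℝ (ξ j) (vertex ρ γ j)) k) (hξ.inv_pos k).le
      (hξ.inv_lt_one k).le).mono fun j => ?_
    · linarith [cyclicCoeff_pos hξ.inv_pos hξ.inv_lt_one k j, pow_le_one₀ hq0 hq1 (n := r)]
    · linarith [cyclicCoeff_le_one hξ.inv_pos hξ.inv_lt_one k j, pow_nonneg hq0 r]
    · rw [cyclicCoeff_eq_of_isCyclicPred (fun k => 1 / κ k) hD hk j, pow_succ]
      linarith [mul_le_mul_of_nonneg_left (hq k) (pow_nonneg hq0 r)]

lemma exists_rate (hξ : IsTNConfigurationWith ξ ρ γ κ) :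
    ∃ q : ℝ, 0 ≤ q ∧ q < 1 ∧ ∀ k, 1 - 1 / κ k ≤ q := by
  rcases isEmpty_or_nonempty (Fin N) with h | h
  · exact ⟨0, le_rfl, zero_lt_one, fun k => isEmptyElim k⟩
  · obtain ⟨k, hk⟩ := Finite.exists_max fun k => 1 - 1 / κ k
    exact ⟨1 - 1 / κ k, by linarith [hξ.inv_lt_one k], by linarith [hξ.inv_pos k], hk⟩

lemma approximable_blockWeight (hξ : IsTNConfigurationWith ξ ρ γ κ) (i : Fin N) {μ : ℝ}
    (hμ0 : 0 ≤ μ) (hμ1 : μ ≤ 1) {e : ℝ} (he : 0 < e) :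
    Approximable (configSet ξ ρ γ) ξ (μ • ξ i + (1 - μ) • vertex ρ γ i)
      (fun j => blockWeight κ i μ j - e) := by
  obtain ⟨q, hq0, hq1, hq⟩ := hξ.exists_rate
  obtain ⟨r, hr⟩ := exists_pow_lt_of_lt_one he hq1
  refine ((hξ.approximable_vertex hq0 hq1.le hq r i).segment (fun j => abs_le.2 ⟨?_, ?_⟩)
    (hξ.sub_vertex_mem_waveCone i)
    (Set.subset_iUnion (fun j => segment ℝ (ξ j) (vertex ρ γ j)) i) hμ0 hμ1).mono fun j => ?_
  · linarith [cyclicCoeff_pos hξ.inv_pos hξ.inv_lt_one i j, pow_le_one₀ hq0 hq1.le (n := r)]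
  · linarith [cyclicCoeff_le_one hξ.inv_pos hξ.inv_lt_one i j, pow_nonneg hq0 r]
  · rw [blockWeight_eq]
    linarith [mul_nonneg hμ0 (pow_nonneg hq0 r)]

end IsTNConfigurationWith

/-- Converts an additive loss in the weights into a relative one. -/
lemma exists_pos_le_of_pos {ι : Type*} [Finite ι] (w : ι → ℝ) :
    ∃ e > 0, ∀ j, 0 < w j → e ≤ w j := by
  rcases isEmpty_or_nonempty ι with h | h
  · exact ⟨1, one_pos, fun j => isEmptyElim j⟩
  -- The default `1` for nonpositive entries keeps the minimum positive.
  · obtain ⟨k, hk⟩ := Finite.exists_min fun j => if 0 < w j then w j else 1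
    refine ⟨_, ?_, fun j hj => (hk j).trans_eq (if_pos hj)⟩
    split_ifs with h0
    · exact h0
    · exact one_pos

lemma eLpNorm_top_le_of_norm_lt {X F : Type*} [MeasurableSpace X] [NormedAddCommGroup F]
    {f : X → F} {C : ℝ} (ν : Measure X) (h : ∀ x, ‖f x‖ < C) :
    eLpNorm f ⊤ ν ≤ ENNReal.ofReal C := by
  rw [eLpNorm_exponent_top]
  exact eLpNormEssSup_le_of_ae_bound (Filter.Eventually.of_forall fun x => (h x).le)

end Configuration

end

theorem theorem3p3 (m n N : ℕ) (hm : 1 ≤ m) (hn : 1 ≤ n) (hN : 2 ≤ N)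
    (ξ : Fin N → MatPair m n) (ρ : MatPair m n) (γ : Fin N → MatPair m n) (κ : Fin N → ℝ)
    (hξ : IsTNConfigurationWith ξ ρ γ κ)
    (i : Fin N) (μ : ℝ) (hμ0 : 0 ≤ μ) (hμ1 : μ ≤ 1)
    (η : MatPair m n) (hη : η = μ • ξ i + (1 - μ) • vertex ρ γ i) :
    (η = ∑ j, blockWeight κ i μ j • ξ j ∧
      (∀ j, 0 ≤ blockWeight κ i μ j) ∧ ∑ j, blockWeight κ i μ j = 1) ∧
    ∀ G : Set (SpaceTime n), IsOpen G → Bornology.IsBounded G → ∀ δ : ℝ, 0 < δ → δ < 1 →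
      ∃ (φ : SpaceTime n → EuclideanSpace ℝ (Fin m)) (ψ g : SpaceTime n → Mat m n),
        IsTestFunction G φ ∧ IsTestFunction G ψ ∧ IsTestFunction G g ∧
        (∀ z ∈ G, spaceDiv ψ z = 0 ∧ spaceDiv g z = φ z ∧
          η + mkPair (spaceGrad φ z) (dTime ψ z) ∈ Metric.thickening δ (configSet ξ ρ γ)) ∧
        eLpNorm φ ⊤ (volume.restrict G) + eLpNorm (dTime φ) ⊤ (volume.restrict G) +
          eLpNorm (dTime g) ⊤ (volume.restrict G) < ENNReal.ofReal δ ∧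
        ∃ U : Fin N → Set (SpaceTime n),
          (∀ j k, j ≠ k → Disjoint (U j) (U k)) ∧
          (∀ j, IsOpen (U j) ∧ IsCompact (closure (U j)) ∧ closure (U j) ⊆ G ∧
            (∀ z ∈ U j, η + mkPair (spaceGrad φ z) (dTime ψ z) = ξ j) ∧
            (1 - δ) * blockWeight κ i μ j * volume.real G ≤ volume.real (U j)) ∧
          volume.real (⋃ j, U j) = ∑ j, volume.real (U j) ∧
          (1 - δ) * volume.real G ≤ ∑ j, volume.real (U j) := by
  have hw0 := hξ.blockWeight_nonneg i hμ0 hμ1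
  have hw1 := hξ.sum_blockWeight i μ
  refine ⟨⟨by rw [hη, hξ.sum_blockWeight_smul], hw0, hw1⟩, fun G hG hGb δ hδ _ => ?_⟩
  obtain ⟨e, he, hew⟩ := exists_pos_le_of_pos fun j => blockWeight κ i μ j
  have hδe : 0 < δ * e / 2 := by positivity
  -- Three sup norms below `δ / 4` add up to less than `δ`. The iteration and the approximation each
  -- cost at most `δ e / 2`, in total at most `δ` times any positive weight.
  set δ' := min (δ / 4) (δ * e / 2) with hδ'
  have hd0 : 0 < δ' := lt_min (by linarith) hδe
  have hd1 : δ' ≤ δ / 4 := min_le_left _ _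
  have hd2 : δ' ≤ δ * e / 2 := min_le_right _ _
  obtain ⟨φ, ψ, g, hφ, hψ, hg, h1, h2, U, hU, h3⟩ :=
    hξ.approximable_blockWeight i hμ0 hμ1 hδe G hG hGb δ' hd0
  rw [← hη] at h1 h3
  have hG0 : 0 ≤ volume.real G := measureReal_nonneg
  have hUm : ∀ j, (1 - δ) * blockWeight κ i μ j * volume.real G ≤ volume.real (U j) := fun j => by
    rcases (hw0 j).eq_or_lt with h | h
    · rw [← h, mul_zero, zero_mul]
      exact measureReal_nonneg
    · refine le_trans (mul_le_mul_of_nonneg_right ?_ hG0) (h3 j).2.2.2.2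
      linarith [mul_le_mul_of_nonneg_left (hew j h) hδ.le]
  refine ⟨φ, ψ, g, hφ, hψ, hg, fun z _ => ⟨(h1 z).1, (h1 z).2.1,
    Metric.thickening_mono (by linarith) _ (h1 z).2.2⟩, ?_, U, hU,
    fun j => ⟨(h3 j).1, (h3 j).2.1, (h3 j).2.2.1, (h3 j).2.2.2.1, hUm j⟩, ?_, ?_⟩
  · calc _ ≤ ENNReal.ofReal δ' + ENNReal.ofReal δ' + ENNReal.ofReal δ' :=
          add_le_add (add_le_add (eLpNorm_top_le_of_norm_lt _ fun z => (h2 z).1)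
            (eLpNorm_top_le_of_norm_lt _ fun z => (h2 z).2.1))
            (eLpNorm_top_le_of_norm_lt _ fun z => (h2 z).2.2)
      _ = ENNReal.ofReal (δ' + δ' + δ') := by
          rw [ENNReal.ofReal_add (by positivity) hd0.le, ENNReal.ofReal_add hd0.le hd0.le]
      _ < ENNReal.ofReal δ := (ENNReal.ofReal_lt_ofReal_iff hδ).2 (by linarith)
  · exact measureReal_iUnion_fintype (fun j k hjk => hU j k hjk) (fun j => (h3 j).1.measurableSet)
      fun j => ne_top_of_le_ne_top hGb.measure_lt_top.ne
        (measure_mono (subset_closure.trans (h3 j).2.2.1))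
  · calc (1 - δ) * volume.real G = ∑ j, (1 - δ) * blockWeight κ i μ j * volume.real G := by
          rw [← Finset.sum_mul, ← Finset.mul_sum, hw1, mul_one]
      _ ≤ _ := Finset.sum_le_sum fun j _ => hUm j
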